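/- Theorem 3. Let $d\ge 1$, $L>0$ and let $m\ge 1$ be an integer. Admissible covariances. Let $C=(C_{k\ell})_{1\le k,\ell\le 2}$ be a matrix-valued stationary covariance function on $\mathbb R^d$ with $C_{12}=C_{21}$ and $C_{k\ell}(u)=K_{k\ell}(\|u\|)+r_{k\ell}(u)$, where for each $k,\ell$ there are a constant $c_{k\ell}$ (non-zero if $k=\ell$) and an exponent $\alpha_{k\ell}>0$ that is not an even integer such that: (i) $K_{k\ell}=A+B$ with $A$ even and real-analytic on $\mathbb R$, $B$ even, continuous on $[-L,L]$ and infinitely differentiable on $(0,L]$, and for every $p\ge 0$, $B^{(p)}(t)=\alpha_{k\ell}(\alpha_{k\ell}-1)\cdots(\alpha_{k\ell}-p+1)\,c_{k\ell}\,t^{\alpha_{k\ell}-p}+o(t^{\alpha_{k\ell}-p})$ as $t\downarrow 0$; (ii) $r_{k\ell}(u)=o(\|u\|^{\alpha_{k\ell}})$ as $u\to 0$, $r_{k\ell}$ is infinitely differentiable on $\mathbb R^d\setminus\{0\}$, and for every $p\ge 0$ its partial derivatives of order $p$ are $o(\|u\|^{\alpha_{k\ell}-p})$ as $u\to 0$,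 $u\ne 0$. Assume moreover $$\alpha_{11}<\alpha_{12},\qquad \alpha_{11}<\alpha_{22}+d,\qquad \alpha_{11}<4m .$$ Model. Let $(X,W)$ be a bivariate stationary Gaussian random field on $\mathbb R^d$ with such a covariance function, i.e. $X(s),W(s)$, $s\in\mathbb R^d$, are jointly Gaussian with constant means and $\mathrm{Cov}(Z_k(s+u),Z_\ell(s))=C_{k\ell}(u)$ for $Z=(X,W)$, and let $Y(s)=X(s)\beta+W(s)$ with $\beta\in\mathbb R$. Estimator. For $n\ge 1$ put $h=L/n$ and let $\mathcal G_n^{(m)}$ be the set of points $hj$, $j\in\{m,\dots,n-m\}^d$, i.e. the regular grid of $(n+1)^d$ points in $[0,L]^d$ with $m$ outer layers removed. Let $\Delta_h z(s)=h^{-2}\sum_{g=1}^d\{z(s+he_g)+z(s-he_g)-2z(s)\}$, let $\Delta_h^{(m)}$ be its $m$-th iterate, and let $$\mathrm{LAP}_n^{(m)}(X,Y)=\frac{\sum_{s\in\mathcal G_n^{(m)}}\Delta_h^{(m)}X(s)\,\Delta_h^{(m)}Y(s)}{\sum_{s\in\mathcal G_n^{(m)}}\{\Delta_h^{(m)}X(s)\}^2}.$$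 Then $\beta$ is consistently estimable from the paths of $(X,Y)$ on $[0,L]^d$: there is one sequence $T_n$ of measurable functions of the path $(X(s),Y(s))_{s\in[0,L]^d}$ such that $T_n\to\beta$ in probability under every model as above (every $\beta$ and every law of $(X,W)$ with $\alpha_{11}<4m$). Concretely, $\mathrm{LAP}_n^{(m)}(X,Y)\to\beta$ in probability as $n\to\infty$. -/

import Mathlib

open Set Filter Topology MeasureTheory ProbabilityTheory Asymptotics

/-- The falling factorial `α (α - 1) ⋯ (α - k + 1) = Γ(α + 1) / Γ(α + 1 - k)` of a real number. -/
def fallingFactorial (α : ℝ) (k : ℕ) : ℝ := ∏ i ∈ Finset.range k, (α - i)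

/-- `K = A + B` with `A` even and real-analytic and `B` even, continuous on `[-L, L]`, smooth on
`(0, L]`, and `B^{(k)}(t) = (α)_k c t^{α - k} + o(t^{α - k})` as `t ↓ 0` for every `k ≥ 0`.
The exponent `α` is positive and not an even integer. -/
structure HasPrincipalIrregularTerm (K : ℝ → ℝ) (L α c : ℝ) : Prop where
  exponent_pos : 0 < α
  exponent_not_even : ∀ k : ℕ, α ≠ 2 * (k : ℝ)
  decomposition : ∃ A B : ℝ → ℝ,
    (∀ t, K t = A t + B t) ∧
    (∀ t, A (-t) = A t) ∧ AnalyticOnNhd ℝ A univ ∧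
    (∀ t, B (-t) = B t) ∧ ContinuousOn B (Icc (-L) L) ∧ ContDiffOn ℝ ((⊤ : ℕ∞) : WithTop ℕ∞) B (Ioc 0 L) ∧
    ∀ k : ℕ, (fun t : ℝ => iteratedDeriv k B t - fallingFactorial α k * c * t ^ (α - k))
      =o[𝓝[>] 0] (fun t : ℝ => t ^ (α - k))

/-- A `2 × 2` matrix-valued function `C` on `ℝ^d` with `C₁₂ = C₂₁`, each entry of which is
`C_{kl}(u) = K_{kl}(‖u‖) + r_{kl}(u)` with `K_{kl}` having a principal irregular term of exponent
`α_{kl}` (with non-zero coefficient if `k = l`), `r_{kl}(u) = o(‖u‖^{α_{kl}})` as `u → 0`, and `r_{kl}`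
smooth away from the origin with all partial derivatives of order `p` being
`o(‖u‖^{α_{kl} - p})` as `u → 0`, `u ≠ 0`. -/
structure IsIsotropicUpToRemainder {d : ℕ}
    (C : Fin 2 → Fin 2 → EuclideanSpace ℝ (Fin d) → ℝ) (L : ℝ) (α : Fin 2 → Fin 2 → ℝ) :
    Prop where
  cross_symm : C 0 1 = C 1 0
  decomposition : ∀ k l : Fin 2, ∃ (c : ℝ) (K : ℝ → ℝ) (r : EuclideanSpace ℝ (Fin d) → ℝ),
    (k = l → c ≠ 0) ∧
    HasPrincipalIrregularTerm K L (α k l) c ∧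
    (∀ u, C k l u = K ‖u‖ + r u) ∧
    r =o[𝓝 0] (fun u => ‖u‖ ^ α k l) ∧
    ContDiffOn ℝ ((⊤ : ℕ∞) : WithTop ℕ∞) r {0}ᶜ ∧
    ∀ p : ℕ, (fun u => iteratedFDeriv ℝ p r u) =o[𝓝[≠] 0] (fun u => ‖u‖ ^ (α k l - p))

/-- `(X, W)` is a bivariate stationary Gaussian random field on `ℝ^d`: the real random variables
`X(s), W(s)`, `s ∈ ℝ^d`, are jointly Gaussian, their means do not depend on `s`, and
`C_{kl}(u) = Cov(Z_k(s + u), Z_l(s))` for every `s`, where `Z = (X, W)`. -/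
structure IsStationaryGRF {d : ℕ} {Ω : Type*} [MeasurableSpace Ω] (P : Measure Ω)
    (X W : EuclideanSpace ℝ (Fin d) → Ω → ℝ)
    (C : Fin 2 → Fin 2 → EuclideanSpace ℝ (Fin d) → ℝ) : Prop where
  measurable : ∀ k s, Measurable ((![X, W] : Fin 2 → _) k s)
  gaussian : IsGaussianProcess
    (fun z : Fin 2 × EuclideanSpace ℝ (Fin d) => (![X, W] : Fin 2 → _) z.1 z.2) P
  mean : ∀ k, ∃ μ : ℝ, ∀ s, ∫ ω, (![X, W] : Fin 2 → _) k s ω ∂P = μ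
  cov : ∀ k l s u,
    covariance ((![X, W] : Fin 2 → _) k (s + u)) ((![X, W] : Fin 2 → _) l s) P = C k l u

/-- The first order discrete Laplacian with step `h`. -/
noncomputable def discreteLaplacian {d : ℕ} (h : ℝ) (z : EuclideanSpace ℝ (Fin d) → ℝ) :
    EuclideanSpace ℝ (Fin d) → ℝ := fun s =>
  1 / h ^ 2 * ∑ g : Fin d, (z (s + h • EuclideanSpace.single g (1 : ℝ))
    + z (s - h • EuclideanSpace.single g (1 : ℝ)) - 2 * z s)

/-- Indices of the grid with `(n + 1)^d` points after `m` outer layers have been removed. -/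
def gridInterior (d n m : ℕ) : Finset (Fin d → ℕ) :=
  Fintype.piFinset fun _ => Finset.Icc m (n - m)

/-- The point of index `j` of the regular grid with step `h`. -/
noncomputable def gridPoint {d : ℕ} (h : ℝ) (j : Fin d → ℕ) : EuclideanSpace ℝ (Fin d) :=
  WithLp.toLp 2 fun g => h * (j g : ℝ)

/-- The ordinary least squares coefficient in the regression of the `m`-th order discrete Laplacians
of `z₂` on those of `z₁` over the regular grid of `(n + 1)^d` points in `[0, L]^d`. For `s` in the
`m`-th interior, the `m`-th Laplacian at `s` involves only values at points of that grid. -/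
noncomputable def lapEstimator {d : ℕ} (L : ℝ) (m n : ℕ)
    (z₁ z₂ : EuclideanSpace ℝ (Fin d) → ℝ) : ℝ :=
  (∑ j ∈ gridInterior d n m,
      (discreteLaplacian (L / n))^[m] z₁ (gridPoint (L / n) j)
        * (discreteLaplacian (L / n))^[m] z₂ (gridPoint (L / n) j))
    / ∑ j ∈ gridInterior d n m, ((discreteLaplacian (L / n))^[m] z₁ (gridPoint (L / n) j)) ^ 2

/-- The cube `[0, L]^d`. -/
def cube (d : ℕ) (L : ℝ) : Set (EuclideanSpace ℝ (Fin d)) := {s | ∀ g, s g ∈ Icc 0 L}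

/-- All pairs of a slope `β` and a law of the paths `s ↦ (X(s), Y(s))` on `[0, L]^d`, where
`Y = X β + W` and `(X, W)` is any stationary Gaussian random field whose covariance function is
isotropic up to a remainder, with exponents such that `α₁₁ < α₁₂`, `α₁₁ < α₂₂ + d` and
`α₁₁ < 4 m`. -/
def slopeModels (d : ℕ) (L : ℝ) (m : ℕ) : Set (ℝ × Measure (cube d L → ℝ × ℝ)) :=
  {q | ∃ (Ω : Type) (_ : MeasurableSpace Ω) (P : Measure Ω)
      (X W : EuclideanSpace ℝ (Fin d) → Ω → ℝ)
      (C : Fin 2 → Fin 2 → EuclideanSpace ℝ (Fin d) → ℝ) (α : Fin 2 → Fin 2 → ℝ),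
    IsProbabilityMeasure P ∧ IsStationaryGRF P X W C ∧ IsIsotropicUpToRemainder C L α ∧
    α 0 0 < α 0 1 ∧ α 0 0 < α 1 1 + d ∧ α 0 0 < 4 * m ∧
    q.2 = P.map (fun ω (s : cube d L) => (X s ω, X s ω * q.1 + W s ω))}

/-- The real parameter is consistently estimable over a set of pairs (parameter, law of the
observation): one sequence of estimators, i.e. measurable functions of the observation, converges in
probability to the parameter under every pair of the set. -/
def ConsistentlyEstimable {S : Type*} [MeasurableSpace S] (M : Set (ℝ × Measure S)) : Prop :=
  ∃ T : ℕ → S → ℝ, (∀ n, Measurable (T n)) ∧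
    ∀ q ∈ M, TendstoInMeasure q.2 T atTop (fun _ => q.1)

/-! The `m`-th iterated Laplacians of the field form a centred stationary Gaussian field on the
grid, with covariances `Δ_h ^ (2 m)` of `C_kl` at the lags. The analytic part of `C_kl` contributes
`O(1)`, and the irregular part, of size `‖u‖ ^ α`, contributes `O((h + ‖u‖) ^ (α - 4 m))`; since
`‖u‖ ^ α` is homogeneous, `h ^ (4 m - α) Δ_h ^ (2 m) C_kl (h u)` converges to a multiple of
`Δ_1 ^ (2 m) ‖u‖ ^ α`. For `k = l` this limit is itself a stationary covariance which is not
identically zero, `α` being no even integer, so by Cauchy–Schwarz it is positive at lag `0`.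

Hence `h ^ (4 m - α_11)` times the grid averages of `(Δ X) ^ 2` and `Δ X Δ W` have means converging
to a positive number and to zero (as `α_11 < α_12`). By Isserlis' formula their variances are
lattice sums of products of two such covariances and vanish in the limit (as `α_11 < α_22 + d` for
the second). The hypotheses bound the covariances only at small lags, so the grid is first cut into
finitely many small blocks and the variance of the sum is bounded by those of the blocks. The
estimator is `β` plus the quotient of the second average by the first. -/

section FiniteDifferences

open scoped ContDiff

variable {E F : Type*} [NormedAddCommGroup E] [NormedSpace ℝ E] [NormedAddCommGroup F]
  [NormedSpace ℝ F]

theorem norm_iteratedFDeriv_add_right_sub_le {f : E → F} {U : Set E} {p : ℕ} {B : ℝ}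
    (hU : IsOpen U) (hconv : Convex ℝ U) (hf : ContDiffOn ℝ (p + 1 : ℕ) f U)
    (hB : ∀ x ∈ U, ‖iteratedFDeriv ℝ (p + 1) f x‖ ≤ B) {x v : E} (hx : x ∈ U) (hxv : x + v ∈ U) :
    ‖iteratedFDeriv ℝ p (fun y => f (y + v) - f y) x‖ ≤ B * ‖v‖ := by
  have hfU : ∀ y ∈ U, ContDiffAt ℝ (p + 1 : ℕ) f y := fun y hy => hf.contDiffAt (hU.mem_nhds hy)
  have hp : (p : ℕ∞ω) ≤ (p + 1 : ℕ) := by exact_mod_cast p.le_succ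
  have hshift : ContDiffAt ℝ (p + 1 : ℕ) (fun y => f (y + v)) x :=
    ContDiffAt.comp x (f := fun y => y + v) (hfU _ hxv) (contDiffAt_id.add contDiffAt_const)
  have hsub : iteratedFDeriv ℝ p (fun y => f (y + v) - f y) x =
      iteratedFDeriv ℝ p f (x + v) - iteratedFDeriv ℝ p f x := by
    rw [← iteratedFDeriv_comp_add_right]
    exact iteratedFDeriv_sub_apply (hshift.of_le hp) ((hfU x hx).of_le hp)
  have hmvt := hconv.norm_image_sub_le_of_norm_fderiv_le (𝕜 := ℝ) (f := iteratedFDeriv ℝ p f)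
    (fun y hy => (hfU y hy).differentiableAt_iteratedFDeriv (by exact_mod_cast p.lt_succ_self))
    (fun y hy => by rw [norm_fderiv_iteratedFDeriv]; exact hB y hy) hx hxv
  rwa [hsub, ← add_sub_cancel_left x v, add_sub_cancel]

/-- The central second difference of `f` in the direction `v`; the discrete Laplacian is the sum of
those along the coordinate axes, divided by the square of the step. -/
def secondDifference (v : E) (f : E → F) (x : E) : F := f (x + v) + f (x - v) - (2 : ℝ) • f x

theorem norm_iteratedFDeriv_secondDifference_le {f : E → F} {U : Set E} {p : ℕ} {B : ℝ}
    (hU : IsOpen U) (hconv : Convex ℝ U) (hf : ContDiffOn ℝ (p + 2 : ℕ) f U)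
    (hB : ∀ x ∈ U, ‖iteratedFDeriv ℝ (p + 2) f x‖ ≤ B) {x v : E} (hx : x ∈ U) (hxv : x + v ∈ U)
    (hxv' : x - v ∈ U) :
    ‖iteratedFDeriv ℝ p (secondDifference v f) x‖ ≤ B * ‖v‖ ^ 2 := by
  have hcont : Continuous fun y : E => y + v := by fun_prop
  set V : Set E := U ∩ (fun y => y + v) ⁻¹' U
  have hV : IsOpen V := hU.inter (hU.preimage hcont)
  have hVconv : Convex ℝ V := hconv.inter (hconv.translate_preimage_left v)
  have hdiff : ContDiffOn ℝ (p + 1 : ℕ) (fun y => f (y + v) - f y) V := by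
    have hle : ((p + 1 : ℕ) : ℕ∞ω) ≤ (p + 2 : ℕ) := by exact_mod_cast (p + 1).le_succ
    refine ContDiffOn.sub ?_ ((hf.mono inter_subset_left).of_le hle)
    exact (hf.of_le hle).comp (contDiff_id.add contDiff_const).contDiffOn inter_subset_right
  have hdiffB : ∀ y ∈ V, ‖iteratedFDeriv ℝ (p + 1) (fun y => f (y + v) - f y) y‖ ≤ B * ‖v‖ :=
    fun y hy => norm_iteratedFDeriv_add_right_sub_le hU hconv hf hB hy.1 hy.2
  have hneg : secondDifference v f = -fun y => (fun z => f (z + v) - f z) (y + -v) -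
      (fun z => f (z + v) - f z) y := by
    funext y
    simp only [secondDifference, Pi.neg_apply, neg_add_cancel_right, two_smul,
      ← sub_eq_add_neg y v]
    abel
  rw [hneg, iteratedFDeriv_neg_apply, norm_neg]
  refine (norm_iteratedFDeriv_add_right_sub_le hV hVconv hdiff hdiffB ⟨hx, hxv⟩
    ⟨by rwa [← sub_eq_add_neg], by simpa using hx⟩).trans (le_of_eq ?_)
  rw [norm_neg]
  ring

theorem contDiffAt_secondDifference {f : E → F} {n : ℕ∞ω} {x v : E} (hx : ContDiffAt ℝ n f x)
    (hxv : ContDiffAt ℝ n f (x + v)) (hxv' : ContDiffAt ℝ n f (x - v)) :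
    ContDiffAt ℝ n (secondDifference v f) x :=
  ((ContDiffAt.comp x (f := fun y => y + v) hxv (by fun_prop)).add
    (ContDiffAt.comp x (f := fun y => y - v) hxv' (by fun_prop))).sub (contDiffAt_const.smul hx)

end FiniteDifferences

section DiscreteLaplacian

open scoped ContDiff

variable {d : ℕ}

/-- The discrete Laplacian with step `h` as a linear operator on functions. -/
noncomputable def discreteLaplacianLinearMap (d : ℕ) (h : ℝ) :
    (EuclideanSpace ℝ (Fin d) → ℝ) →ₗ[ℝ] (EuclideanSpace ℝ (Fin d) → ℝ) where
  toFun := discreteLaplacian h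
  map_add' f g := by
    funext s
    simp only [discreteLaplacian, Pi.add_apply, ← mul_add, ← Finset.sum_add_distrib]
    congr! 2
    ring
  map_smul' c f := by
    funext s
    simp only [discreteLaplacian, Pi.smul_apply, smul_eq_mul, RingHom.id_apply]
    rw [mul_left_comm c, Finset.mul_sum _ _ c]
    congr! 2
    ring

theorem iterate_discreteLaplacian_add (h : ℝ) (M : ℕ) (f g : EuclideanSpace ℝ (Fin d) → ℝ) :
    (discreteLaplacian h)^[M] (f + g) = (discreteLaplacian h)^[M] f + (discreteLaplacian h)^[M] g :=
  iterate_map_add (discreteLaplacianLinearMap d h) M f g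

theorem iterate_discreteLaplacian_smul (h : ℝ) (M : ℕ) (c : ℝ)
    (f : EuclideanSpace ℝ (Fin d) → ℝ) :
    (discreteLaplacian h)^[M] (c • f) = c • (discreteLaplacian h)^[M] f := by
  have := ((discreteLaplacianLinearMap d h) ^ M).map_smul c f
  rwa [Module.End.coe_pow] at this

theorem discreteLaplacian_const (h c : ℝ) :
    discreteLaplacian h (fun _ : EuclideanSpace ℝ (Fin d) => c) = 0 := by
  funext s
  simp [discreteLaplacian, ← two_mul]

theorem iterate_discreteLaplacian_const {M : ℕ} (hM : M ≠ 0) (h c : ℝ) :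
    (discreteLaplacian h)^[M] (fun _ : EuclideanSpace ℝ (Fin d) => c) = 0 := by
  obtain ⟨M, rfl⟩ := Nat.exists_eq_succ_of_ne_zero hM
  rw [Function.iterate_succ_apply, discreteLaplacian_const]
  exact iterate_map_zero (discreteLaplacianLinearMap d h) M

theorem continuous_iterate_discreteLaplacian (h : ℝ) (M : ℕ) :
    Continuous (discreteLaplacian (d := d) h)^[M] := by
  refine Continuous.iterate ?_ M
  unfold discreteLaplacian
  fun_prop

/-- The coefficient of the stencil of an iterated discrete Laplacian carried by a choice, at each
iteration, of an axis and of one of the three points of the second difference along it. -/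
def stencilWeight {M : ℕ} (p : Fin M → Fin d × Fin 3) : ℝ := ∏ i, ![1, 1, -2] (p i).2

/-- The displacement, in units of the step, of the node attached to the choices `p`; distinct
choices may lead to the same node. -/
noncomputable def stencilOffset {M : ℕ} (p : Fin M → Fin d × Fin 3) : EuclideanSpace ℝ (Fin d) :=
  ∑ i, (![1, -1, 0] (p i).2 : ℝ) • EuclideanSpace.single (p i).1 1

theorem discreteLaplacian_eq_sum (h : ℝ) (z : EuclideanSpace ℝ (Fin d) → ℝ)
    (s : EuclideanSpace ℝ (Fin d)) :
    discreteLaplacian h z s = 1 / h ^ 2 * ∑ q : Fin d × Fin 3,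
      (![1, 1, -2] q.2 : ℝ) *
        z (s + h • (![1, -1, 0] q.2 : ℝ) • EuclideanSpace.single q.1 (1 : ℝ)) := by
  simp only [discreteLaplacian, Fintype.sum_prod_type, Fin.sum_univ_three, Matrix.cons_val,
    one_smul, neg_smul, smul_neg, zero_smul, smul_zero, add_zero, one_mul, ← sub_eq_add_neg,
    neg_mul]

theorem iterate_discreteLaplacian_eq_sum (h : ℝ) (M : ℕ) (z : EuclideanSpace ℝ (Fin d) → ℝ)
    (s : EuclideanSpace ℝ (Fin d)) :
    (discreteLaplacian h)^[M] z s =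
      (1 / h ^ 2) ^ M * ∑ p : Fin M → Fin d × Fin 3,
        stencilWeight p * z (s + h • stencilOffset p) := by
  induction M generalizing s with
  | zero => simp [stencilWeight, stencilOffset]
  | succ M ih =>
    rw [Function.iterate_succ_apply', ← (Fin.consEquiv fun _ => Fin d × Fin 3).sum_comp,
      discreteLaplacian_eq_sum, pow_succ' _ M, mul_assoc]
    simp only [ih, stencilWeight, stencilOffset, Fin.consEquiv, Equiv.coe_fn_mk,
      Fin.prod_univ_succ, Fin.sum_univ_succ (n := M), Fin.cons_zero, Fin.cons_succ, smul_add,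
      add_assoc, Finset.mul_sum, Fintype.sum_prod_type]
    congr! 4
    ring

theorem norm_stencilOffset_le {M : ℕ} (p : Fin M → Fin d × Fin 3) : ‖stencilOffset p‖ ≤ M := by
  have hstep : ∀ j : Fin 3, |(![1, -1, 0] j : ℝ)| ≤ 1 := fun j => by fin_cases j <;> simp
  refine (norm_sum_le_of_le _ (n := fun _ => (1 : ℝ)) fun i _ => ?_).trans (by simp)
  rw [norm_smul, PiLp.norm_single, norm_one, mul_one]
  exact hstep _

theorem iterate_discreteLaplacian_congr {h : ℝ} {M : ℕ} {f g : EuclideanSpace ℝ (Fin d) → ℝ}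
    {s : EuclideanSpace ℝ (Fin d)} (hfg : ∀ x, ‖x - s‖ ≤ M * |h| → f x = g x) :
    (discreteLaplacian h)^[M] f s = (discreteLaplacian h)^[M] g s := by
  rw [iterate_discreteLaplacian_eq_sum, iterate_discreteLaplacian_eq_sum]
  congr! 3 with p
  refine hfg _ ?_
  rw [add_sub_cancel_left, norm_smul, mul_comm, Real.norm_eq_abs]
  exact mul_le_mul_of_nonneg_right (norm_stencilOffset_le p) (abs_nonneg h)

theorem abs_iterate_discreteLaplacian_le_of_abs_le {h b : ℝ} {M : ℕ}
    {f : EuclideanSpace ℝ (Fin d) → ℝ} {u : EuclideanSpace ℝ (Fin d)}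
    (hf : ∀ x, ‖x - u‖ ≤ M * |h| → |f x| ≤ b) :
    |(discreteLaplacian h)^[M] f u| ≤
      (∑ p : Fin M → Fin d × Fin 3, |stencilWeight p|) * ((1 / h ^ 2) ^ M * b) := by
  have hterm : ∀ p : Fin M → Fin d × Fin 3,
      |stencilWeight p * f (u + h • stencilOffset p)| ≤ |stencilWeight p| * b := fun p => by
    rw [abs_mul]
    refine mul_le_mul_of_nonneg_left (hf _ ?_) (abs_nonneg _)
    rw [add_sub_cancel_left, norm_smul, mul_comm, Real.norm_eq_abs]
    exact mul_le_mul_of_nonneg_right (norm_stencilOffset_le p) (abs_nonneg h)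
  rw [iterate_discreteLaplacian_eq_sum, abs_mul, abs_of_nonneg (by positivity), mul_left_comm,
    Finset.sum_mul]
  gcongr
  exact (Finset.abs_sum_le_sum_abs _ _).trans (Finset.sum_le_sum fun p _ => hterm p)

theorem iterate_discreteLaplacian_smul_eq (h : ℝ) (M : ℕ) (z : EuclideanSpace ℝ (Fin d) → ℝ)
    (u : EuclideanSpace ℝ (Fin d)) :
    (discreteLaplacian h)^[M] z (h • u) =
      (1 / h ^ 2) ^ M * (discreteLaplacian 1)^[M] (fun x => z (h • x)) u := by
  simp only [iterate_discreteLaplacian_eq_sum, one_smul, one_pow, div_one, one_mul, smul_add]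

theorem discreteLaplacian_eq_sum_secondDifference (h : ℝ) (f : EuclideanSpace ℝ (Fin d) → ℝ) :
    discreteLaplacian h f = (1 / h ^ 2) • fun s =>
      ∑ g, secondDifference (h • EuclideanSpace.single g (1 : ℝ)) f s := rfl

theorem norm_smul_single_one (h : ℝ) (g : Fin d) :
    ‖h • (EuclideanSpace.single g (1 : ℝ) : EuclideanSpace ℝ (Fin d))‖ = |h| := by
  rw [norm_smul, PiLp.norm_single, norm_one, mul_one, Real.norm_eq_abs]

theorem mem_ball_add_smul_single {u x : EuclideanSpace ℝ (Fin d)} {R h : ℝ}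
    (hx : x ∈ Metric.ball u (R - |h|)) (g : Fin d) :
    x + h • EuclideanSpace.single g (1 : ℝ) ∈ Metric.ball u R ∧
      x - h • EuclideanSpace.single g (1 : ℝ) ∈ Metric.ball u R := by
  have hnorm := norm_smul_single_one h g
  rw [mem_ball_iff_norm] at hx
  constructor
  · rw [mem_ball_iff_norm, add_sub_right_comm]
    linarith [norm_add_le (x - u) (h • EuclideanSpace.single g (1 : ℝ))]
  · rw [mem_ball_iff_norm, sub_right_comm]
    linarith [norm_sub_le (x - u) (h • EuclideanSpace.single g (1 : ℝ))]

theorem contDiffOn_discreteLaplacian {f : EuclideanSpace ℝ (Fin d) → ℝ}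
    {u : EuclideanSpace ℝ (Fin d)} {R h : ℝ} {n : ℕ∞ω}
    (hf : ContDiffOn ℝ n f (Metric.ball u R)) :
    ContDiffOn ℝ n (discreteLaplacian h f) (Metric.ball u (R - |h|)) := by
  have hfx : ∀ x ∈ Metric.ball u R, ContDiffAt ℝ n f x := fun x hx =>
    hf.contDiffAt (Metric.isOpen_ball.mem_nhds hx)
  intro x hx
  have hx0 := Metric.ball_subset_ball (sub_le_self R (abs_nonneg h)) hx
  rw [discreteLaplacian_eq_sum_secondDifference]
  refine (contDiffAt_const.smul (ContDiffAt.sum fun g _ => ?_)).contDiffWithinAt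
  exact contDiffAt_secondDifference (hfx x hx0) (hfx _ (mem_ball_add_smul_single hx g).1)
    (hfx _ (mem_ball_add_smul_single hx g).2)

theorem norm_iteratedFDeriv_discreteLaplacian_le {f : EuclideanSpace ℝ (Fin d) → ℝ}
    {u : EuclideanSpace ℝ (Fin d)} {R B h : ℝ} {p : ℕ} (hh : h ≠ 0)
    (hf : ContDiffOn ℝ (p + 2 : ℕ) f (Metric.ball u R))
    (hB : ∀ x ∈ Metric.ball u R, ‖iteratedFDeriv ℝ (p + 2) f x‖ ≤ B)
    {x : EuclideanSpace ℝ (Fin d)} (hx : x ∈ Metric.ball u (R - |h|)) :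
    ‖iteratedFDeriv ℝ p (discreteLaplacian h f) x‖ ≤ d * B := by
  have hfx : ∀ x ∈ Metric.ball u R, ContDiffAt ℝ p f x := fun x hx =>
    (hf.contDiffAt (Metric.isOpen_ball.mem_nhds hx)).of_le (by norm_cast; lia)
  have hx0 := Metric.ball_subset_ball (sub_le_self R (abs_nonneg h)) hx
  have hsmooth : ∀ g, ContDiffAt ℝ p
      (secondDifference (h • EuclideanSpace.single g (1 : ℝ)) f) x := fun g =>
    contDiffAt_secondDifference (hfx x hx0) (hfx _ (mem_ball_add_smul_single hx g).1)
      (hfx _ (mem_ball_add_smul_single hx g).2)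
  have hbound : ∀ g, ‖iteratedFDeriv ℝ p
      (secondDifference (h • EuclideanSpace.single g (1 : ℝ)) f) x‖ ≤ B * h ^ 2 := fun g => by
    have := norm_iteratedFDeriv_secondDifference_le Metric.isOpen_ball (convex_ball u R) hf hB hx0
      (mem_ball_add_smul_single hx g).1 (mem_ball_add_smul_single hx g).2
    rwa [norm_smul_single_one, sq_abs] at this
  rw [discreteLaplacian_eq_sum_secondDifference,
    iteratedFDeriv_const_smul_apply (ContDiffAt.sum fun g _ => hsmooth g),
    iteratedFDeriv_fun_sum_apply fun g _ => hsmooth g, norm_smul,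
    Real.norm_of_nonneg (by positivity)]
  refine (mul_le_mul_of_nonneg_left (norm_sum_le_of_le _ fun g _ => hbound g)
    (by positivity)).trans (le_of_eq ?_)
  rw [Finset.sum_const, Finset.card_univ, Fintype.card_fin, nsmul_eq_mul]
  field_simp

theorem abs_iterate_discreteLaplacian_le {f : EuclideanSpace ℝ (Fin d) → ℝ}
    {u : EuclideanSpace ℝ (Fin d)} {R B h : ℝ} {M : ℕ} (hh : h ≠ 0) (hR : M * |h| < R)
    (hf : ContDiffOn ℝ (2 * M : ℕ) f (Metric.ball u R))
    (hB : ∀ x ∈ Metric.ball u R, ‖iteratedFDeriv ℝ (2 * M) f x‖ ≤ B) :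
    |(discreteLaplacian h)^[M] f u| ≤ d ^ M * B := by
  induction M generalizing f R B with
  | zero => simpa using hB u (Metric.mem_ball_self (by simpa using hR))
  | succ M ih =>
    rw [Function.iterate_succ_apply, pow_succ, mul_assoc]
    refine ih (R := R - |h|) (by push_cast at hR; linarith) ?_ fun x hx =>
      norm_iteratedFDeriv_discreteLaplacian_le hh hf hB hx
    exact contDiffOn_discreteLaplacian (hf.of_le (by norm_cast; lia))

end DiscreteLaplacian

section RadialFunctions

open scoped ContDiff

theorem hasSum_sq_of_hasSum_neg {a : ℕ → ℝ} {t s : ℝ} (h : HasSum (fun n => t ^ n * a n) s)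
    (hneg : HasSum (fun n => (-t) ^ n * a n) s) :
    HasSum (fun i => (t ^ 2) ^ i * a (2 * i)) s := by
  have hmean : HasSum (fun n => (t ^ n * a n + (-t) ^ n * a n) / 2) s := by
    simpa using (h.add hneg).div_const 2
  have hodd : ∀ n ∉ range fun i : ℕ => 2 * i, (t ^ n * a n + (-t) ^ n * a n) / 2 = 0 := by
    intro n hn
    have : Odd n := Nat.not_even_iff_odd.1 fun ⟨k, hk⟩ => hn ⟨k, by simp only; lia⟩
    rw [this.neg_pow]
    ring
  have heven := (Function.Injective.hasSum_iff (fun i j hij => by simpa using hij) hodd).2 hmean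
  refine heven.congr_fun fun i => ?_
  simp [pow_mul]

theorem exists_analyticAt_eventually_eq_comp_sq {A : ℝ → ℝ} (hA : AnalyticAt ℝ A 0)
    (heven : ∀ t, A (-t) = A t) :
    ∃ F : ℝ → ℝ, AnalyticAt ℝ F 0 ∧ ∀ᶠ t in 𝓝 0, A t = F (t ^ 2) := by
  obtain ⟨p, r, hp⟩ := hA
  obtain ⟨ρ, hρ, hρr⟩ := ENNReal.lt_iff_exists_nnreal_btwn.1 hp.r_pos
  set q : FormalMultilinearSeries ℝ ℝ ℝ :=
    FormalMultilinearSeries.ofScalars ℝ fun i => p.coeff (2 * i) with hq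
  obtain ⟨C, -, hC⟩ := p.norm_mul_pow_le_of_lt_radius (hρr.trans_le hp.r_le)
  have hrad : ((ρ ^ 2 : NNReal) : ENNReal) ≤ q.radius := by
    refine q.le_radius_of_bound C fun n => ?_
    have hCn := hC (2 * n)
    rw [pow_mul, FormalMultilinearSeries.norm_apply_eq_norm_coef] at hCn
    rw [FormalMultilinearSeries.ofScalars_norm]
    exact_mod_cast hCn
  have hpos : 0 < q.radius :=
    lt_of_lt_of_le (by exact_mod_cast pow_pos (ENNReal.coe_pos.1 hρ) 2) hrad
  refine ⟨q.sum, (q.hasFPowerSeriesOnBall hpos).analyticAt, ?_⟩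
  have hsum : ∀ s ∈ Metric.eball (0 : ℝ) ρ, HasSum (fun n => s ^ n * p.coeff n) (A s) :=
    fun s hs => by simpa using hp.hasSum (y := s) (Metric.eball_subset_eball hρr.le hs)
  filter_upwards [Metric.eball_mem_nhds (0 : ℝ) hρ] with t ht
  have hneg := hsum (-t) (by simpa using ht)
  rw [heven] at hneg
  rw [← (hasSum_sq_of_hasSum_neg (hsum t ht) hneg).tsum_eq, FormalMultilinearSeries.sum]
  exact tsum_congr fun i => by simp [hq, FormalMultilinearSeries.coeff_ofScalars]

theorem analyticAt_comp_norm {E : Type*} [NormedAddCommGroup E] [InnerProductSpace ℝ E]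
    {A : ℝ → ℝ} (hA : AnalyticAt ℝ A 0) (heven : ∀ t, A (-t) = A t) :
    AnalyticAt ℝ (fun u : E => A ‖u‖) 0 := by
  obtain ⟨F, hF, hAF⟩ := exists_analyticAt_eventually_eq_comp_sq hA heven
  have hsq : AnalyticAt ℝ (fun u : E => ‖u‖ ^ 2) 0 := (contDiff_norm_sq ℝ).contDiffAt.analyticAt
  have hFsq : AnalyticAt ℝ (fun u : E => F (‖u‖ ^ 2)) 0 := by
    refine AnalyticAt.fun_comp (g := F) ?_ hsq
    simpa using hF
  refine hFsq.congr ?_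
  filter_upwards [tendsto_norm_zero.eventually hAF] with u hu using hu.symm

variable {E F G : Type*} [NormedAddCommGroup E] [NormedSpace ℝ E] [NormedAddCommGroup F]
  [NormedSpace ℝ F] [NormedAddCommGroup G] [NormedSpace ℝ G]

theorem norm_iteratedFDeriv_comp_le_of_contDiffAt {g : F → G} {f : E → F} {n : ℕ} {x : E}
    (hg : ContDiffAt ℝ n g (f x)) (hf : ContDiffAt ℝ n f x) {C D : ℝ}
    (hC : ∀ i ≤ n, ‖iteratedFDeriv ℝ i g (f x)‖ ≤ C)
    (hD : ∀ i, 1 ≤ i → i ≤ n → ‖iteratedFDeriv ℝ i f x‖ ≤ D ^ i) :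
    ‖iteratedFDeriv ℝ n (g ∘ f) x‖ ≤ n.factorial * C * D ^ n := by
  have hn : (n : ℕ∞ω) ≠ ∞ := by simp
  obtain ⟨V, hgV, hV, hxV⟩ := eventually_nhds_iff.1 (hg.eventually hn)
  obtain ⟨U, hfU, hU, hxU⟩ := eventually_nhds_iff.1
    ((hf.eventually hn).and (hf.continuousAt.preimage_mem_nhds (hV.mem_nhds hxV)))
  have := norm_iteratedFDerivWithin_comp_le (n := n) (C := C) (D := D)
    (fun y hy => (hgV y hy).contDiffWithinAt) (fun y hy => (hfU y hy).1.contDiffWithinAt) le_rfl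
    hV.uniqueDiffOn hU.uniqueDiffOn (fun y hy => (hfU y hy).2) hxU
    (fun i hi => by rw [iteratedFDerivWithin_of_isOpen i hV hxV]; exact hC i hi)
    (fun i hi1 hi => by rw [iteratedFDerivWithin_of_isOpen i hU hxU]; exact hD i hi1 hi)
  rwa [iteratedFDerivWithin_of_isOpen n hU hxU] at this

theorem norm_iteratedFDeriv_comp_smul_le (N : E → G) {c : ℝ} (hc : c ≠ 0) (i : ℕ) (u : E) :
    ‖iteratedFDeriv ℝ i (fun x => N (c • x)) u‖ ≤ |c| ^ i * ‖iteratedFDeriv ℝ i N (c • u)‖ := by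
  set g : E ≃L[ℝ] E := ContinuousLinearEquiv.smulLeft (Units.mk0 c hc)
  have hcomp := g.iteratedFDerivWithin_comp_right (s := univ) N uniqueDiffOn_univ
    (mem_univ (g u)) i
  rw [preimage_univ, iteratedFDerivWithin_univ, iteratedFDerivWithin_univ] at hcomp
  have hg : ‖(g : E →L[ℝ] E)‖ ≤ |c| := ContinuousLinearMap.opNorm_le_bound _ (abs_nonneg c)
    fun x => (norm_smul c x).le
  change ‖iteratedFDeriv ℝ i (N ∘ g) u‖ ≤ _
  rw [hcomp]
  refine (ContinuousMultilinearMap.norm_compContinuousLinearMap_le _ _).trans ?_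
  rw [mul_comm, Finset.prod_const, Finset.card_univ, Fintype.card_fin]
  exact mul_le_mul_of_nonneg_right (pow_le_pow_left₀ (norm_nonneg _) hg i) (norm_nonneg _)

theorem iteratedDeriv_comp_const_mul_field (B : ℝ → ℝ) (c : ℝ) (k : ℕ) (s : ℝ) :
    iteratedDeriv k (fun s => B (c * s)) s = c ^ k * iteratedDeriv k B (c * s) := by
  induction k generalizing s with
  | zero => simp
  | succ k ih =>
    rw [iteratedDeriv_succ, funext ih, iteratedDeriv_succ, deriv_const_mul_field,
      deriv_comp_mul_left, smul_eq_mul]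
    ring

end RadialFunctions

section RadialDerivatives

open scoped ContDiff

variable (E : Type*) [NormedAddCommGroup E] [InnerProductSpace ℝ E] [FiniteDimensional ℝ E]

theorem exists_norm_iteratedFDeriv_norm_le_of_norm_eq_one (p : ℕ) :
    ∃ D : ℝ, 1 ≤ D ∧ ∀ i ≤ p, ∀ x : E, ‖x‖ = 1 →
      ‖iteratedFDeriv ℝ i (fun y : E => ‖y‖) x‖ ≤ D := by
  have hbdd : ∀ i : ℕ, ∃ D : ℝ, ∀ x : E, ‖x‖ = 1 →
      ‖iteratedFDeriv ℝ i (fun y : E => ‖y‖) x‖ ≤ D := by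
    intro i
    have hcont : ContinuousOn (iteratedFDeriv ℝ i (fun y : E => ‖y‖)) (Metric.sphere 0 1) :=
      fun x hx => (ContDiffAt.continuousAt_iteratedFDeriv
        (contDiffAt_norm ℝ (ne_zero_of_mem_unit_sphere ⟨x, hx⟩)) le_rfl).continuousWithinAt
    obtain ⟨D, hD⟩ := (isCompact_sphere (0 : E) 1).exists_bound_of_continuousOn hcont
    exact ⟨D, fun x hx => hD x (by simpa using hx)⟩
  choose D hD using hbdd
  refine ⟨1 + ∑ i ∈ Finset.range (p + 1), |D i|, le_add_of_nonneg_right (by positivity),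
    fun i hi x hx => ?_⟩
  have := Finset.single_le_sum (f := fun i => |D i|) (fun _ _ => abs_nonneg _)
    (Finset.mem_range.2 (Nat.lt_succ_of_le hi))
  linarith [hD i x hx, le_abs_self (D i)]

theorem exists_norm_iteratedFDeriv_norm_le (p : ℕ) :
    ∃ D : ℝ, ∀ i ≤ p, ∀ x : E, x ≠ 0 →
      ‖iteratedFDeriv ℝ i (fun y : E => ‖y‖) x‖ ≤ ‖x‖ * (D / ‖x‖) ^ i := by
  obtain ⟨D, hD1, hD⟩ := exists_norm_iteratedFDeriv_norm_le_of_norm_eq_one E p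
  refine ⟨D, fun i hi x hx => ?_⟩
  have ht : 0 < ‖x‖ := norm_pos_iff.2 hx
  have hunit : ‖‖x‖⁻¹ • x‖ = 1 := norm_smul_inv_norm hx
  rcases Nat.eq_zero_or_pos i with rfl | hi0
  · simp
  have hhom : (fun y : E => ‖y‖) = ‖x‖ • fun y : E => ‖‖x‖⁻¹ • y‖ := by
    funext y
    rw [Pi.smul_apply, norm_smul, norm_inv, norm_norm, smul_eq_mul, mul_inv_cancel_left₀ ht.ne']
  have hsmooth : ContDiffAt ℝ i (fun y : E => ‖‖x‖⁻¹ • y‖) x :=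
    ContDiffAt.comp x (f := fun y : E => ‖x‖⁻¹ • y) (contDiffAt_norm ℝ (by simpa using hx))
      (by fun_prop)
  calc ‖iteratedFDeriv ℝ i (fun y : E => ‖y‖) x‖
      = ‖x‖ * ‖iteratedFDeriv ℝ i (fun y : E => ‖‖x‖⁻¹ • y‖) x‖ := by
        conv_lhs => rw [hhom]
        rw [iteratedFDeriv_const_smul_apply hsmooth, norm_smul, norm_norm]
    _ ≤ ‖x‖ * (|‖x‖⁻¹| ^ i * ‖iteratedFDeriv ℝ i (fun y : E => ‖y‖) (‖x‖⁻¹ • x)‖) := by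
        gcongr
        exact norm_iteratedFDeriv_comp_smul_le (fun y : E => ‖y‖) (inv_ne_zero ht.ne') i x
    _ ≤ ‖x‖ * (|‖x‖⁻¹| ^ i * D ^ i) := by
        gcongr
        exact (hD i hi _ hunit).trans (le_self_pow₀ hD1 hi0.ne')
    _ = ‖x‖ * (D / ‖x‖) ^ i := by rw [abs_of_pos (inv_pos.2 ht), ← mul_pow, inv_mul_eq_div]

theorem exists_norm_iteratedFDeriv_comp_norm_le (p : ℕ) :
    ∃ D : ℝ, ∀ (B : ℝ → ℝ) (x : E), x ≠ 0 → ContDiffAt ℝ p B ‖x‖ →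
      ‖iteratedFDeriv ℝ p (fun u : E => B ‖u‖) x‖ ≤
        p.factorial * (∑ i ∈ Finset.range (p + 1), ‖x‖ ^ i * |iteratedDeriv i B ‖x‖|) *
          (D / ‖x‖) ^ p := by
  obtain ⟨D, hD⟩ := exists_norm_iteratedFDeriv_norm_le E p
  refine ⟨D, fun B x hx hB => ?_⟩
  have ht : 0 < ‖x‖ := norm_pos_iff.2 hx
  set g : ℝ → ℝ := fun s => B (‖x‖ * s)
  set f : E → ℝ := ‖x‖⁻¹ • fun y : E => ‖y‖
  have hnorm : ContDiffAt ℝ p (fun y : E => ‖y‖) x := contDiffAt_norm ℝ hx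
  have hfx : f x = 1 := inv_mul_cancel₀ ht.ne'
  have hgf : (fun u : E => B ‖u‖) = g ∘ f := by
    funext u
    simp only [g, f, Function.comp_apply, Pi.smul_apply, smul_eq_mul,
      mul_inv_cancel_left₀ ht.ne']
  have hg : ContDiffAt ℝ p g (f x) := by
    refine ContDiffAt.comp (f x) (f := fun s => ‖x‖ * s) ?_ (by fun_prop)
    rwa [hfx, mul_one]
  rw [hgf]
  refine norm_iteratedFDeriv_comp_le_of_contDiffAt hg (contDiffAt_const.smul hnorm)
    (fun i hi => ?_) fun i _ hi => ?_
  · rw [norm_iteratedFDeriv_eq_norm_iteratedDeriv, iteratedDeriv_comp_const_mul_field, hfx,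
      mul_one, norm_mul, Real.norm_of_nonneg (by positivity), Real.norm_eq_abs]
    exact Finset.single_le_sum (f := fun i => ‖x‖ ^ i * |iteratedDeriv i B ‖x‖|)
      (fun _ _ => by positivity) (Finset.mem_range.2 (Nat.lt_succ_of_le hi))
  · rw [iteratedFDeriv_const_smul_apply (hnorm.of_le (by exact_mod_cast hi)), norm_smul, norm_inv,
      norm_norm, inv_mul_le_iff₀ ht]
    exact hD i hi x hx

variable {E}

theorem isBigO_iteratedFDeriv_comp_norm {B : ℝ → ℝ} {α : ℝ}
    (hB : ∀ᶠ t in 𝓝[>] 0, ContDiffAt ℝ ∞ B t)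
    (hO : ∀ i, iteratedDeriv i B =O[𝓝[>] 0] fun t => t ^ (α - i)) (p : ℕ) :
    iteratedFDeriv ℝ p (fun u : E => B ‖u‖) =O[𝓝[≠] 0] fun u => ‖u‖ ^ (α - p) := by
  obtain ⟨D, hD⟩ := exists_norm_iteratedFDeriv_comp_norm_le E p
  have hnorm : Tendsto (fun u : E => ‖u‖) (𝓝[≠] 0) (𝓝[>] 0) := tendsto_norm_nhdsNE_zero
  have hterm : ∀ i : ℕ, (fun t : ℝ => t ^ i * |iteratedDeriv i B t|) =O[𝓝[>] 0]
      fun t => t ^ α := by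
    intro i
    refine ((isBigO_refl (fun t : ℝ => t ^ i) _).mul (hO i).abs_left).congr' .rfl ?_
    filter_upwards [self_mem_nhdsWithin] with t (ht : 0 < t)
    rw [← Real.rpow_natCast, ← Real.rpow_add ht, add_sub_cancel]
  have hsum : (fun t : ℝ => ∑ i ∈ Finset.range (p + 1), t ^ i * |iteratedDeriv i B t|)
      =O[𝓝[>] 0] fun t => t ^ α := IsBigO.fun_sum fun i _ => hterm i
  have hbound : (fun t : ℝ => p.factorial *
      (∑ i ∈ Finset.range (p + 1), t ^ i * |iteratedDeriv i B t|) * (D / t) ^ p)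
      =O[𝓝[>] 0] fun t => t ^ (α - p) := by
    refine ((hsum.const_mul_left _).mul
      (isBigO_refl (fun t : ℝ => (D / t) ^ p) _)).trans (IsBigO.of_bound (|D| ^ p) ?_)
    filter_upwards [self_mem_nhdsWithin] with t (ht : 0 < t)
    rw [Real.rpow_sub ht, Real.rpow_natCast, norm_mul, norm_pow, norm_div, Real.norm_eq_abs D,
      norm_div, norm_pow, Real.norm_of_nonneg ht.le, div_pow]
    exact le_of_eq (by field_simp)
  refine (IsBigO.of_norm_eventuallyLE ?_).trans (hbound.comp_tendsto hnorm)
  filter_upwards [self_mem_nhdsWithin, hnorm.eventually hB] with x hx hBx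
  exact hD B x hx (hBx.of_le (by exact_mod_cast le_top))

end RadialDerivatives

section LocalExpansion

open scoped ContDiff

/-- The function `f` is the sum of a function that is real-analytic near the origin and of an
irregular term `c ‖u‖ ^ α + o(‖u‖ ^ α)` whose derivatives of each order `p` are
`O(‖u‖ ^ (α - p))`. This is all that the small-lag analysis uses of a covariance function. -/
structure HasLocalExpansion {E : Type*} [NormedAddCommGroup E] [NormedSpace ℝ E] (f : E → ℝ)
    (α c : ℝ) : Prop where
  exists_decomposition : ∃ S R : E → ℝ, f = S + R ∧ AnalyticAt ℝ S 0 ∧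
    (∀ᶠ u in 𝓝[≠] 0, ContDiffAt ℝ ∞ R u) ∧
    (∀ p : ℕ, iteratedFDeriv ℝ p R =O[𝓝[≠] 0] fun u => ‖u‖ ^ (α - p)) ∧
    (fun u => R u - c * ‖u‖ ^ α) =o[𝓝 0] fun u => ‖u‖ ^ α

theorem HasLocalExpansion.add_remainder {E : Type*} [NormedAddCommGroup E] [NormedSpace ℝ E]
    {f r : E → ℝ} {α c : ℝ} (hf : HasLocalExpansion f α c)
    (hr : r =o[𝓝 0] fun u => ‖u‖ ^ α) (hsmooth : ContDiffOn ℝ ∞ r {0}ᶜ)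
    (hderiv : ∀ p : ℕ, iteratedFDeriv ℝ p r =o[𝓝[≠] 0] fun u => ‖u‖ ^ (α - p)) :
    HasLocalExpansion (f + r) α c := by
  obtain ⟨S, R, rfl, hS, hRs, hRp, hR⟩ := hf.exists_decomposition
  have hrs : ∀ᶠ u in 𝓝[≠] 0, ContDiffAt ℝ ∞ r u := by
    filter_upwards [self_mem_nhdsWithin] with u hu
    exact hsmooth.contDiffAt (isOpen_compl_singleton.mem_nhds hu)
  refine ⟨S, R + r, add_assoc S R r, hS, hRs.and hrs |>.mono fun u hu => hu.1.add hu.2,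
    fun p => ((hRp p).add (hderiv p).isBigO).congr' ?_ .rfl, ?_⟩
  · have hp : (p : ℕ∞ω) ≤ ∞ := by exact_mod_cast le_top
    filter_upwards [hRs, hrs] with u hu hu'
    exact (iteratedFDeriv_add_apply (hu.of_le hp) (hu'.of_le hp)).symm
  · refine (hR.add hr).congr_left fun u => ?_
    rw [Pi.add_apply]
    ring

theorem isLittleO_comp_norm_of_isLittleO {E : Type*} [NormedAddCommGroup E] {b : ℝ → ℝ} {α : ℝ}
    (hb : b =o[𝓝[>] 0] fun t => t ^ α) (hb0 : b 0 = 0) :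
    (fun u : E => b ‖u‖) =o[𝓝 0] fun u => ‖u‖ ^ α := by
  have hne : (fun u : E => b ‖u‖) =o[𝓝[≠] 0] fun u => ‖u‖ ^ α :=
    hb.comp_tendsto tendsto_norm_nhdsNE_zero
  rw [← nhdsNE_sup_pure]
  refine hne.sup ?_
  rw [isLittleO_pure, norm_zero, hb0]

theorem tendsto_rpow_nhdsGT_zero {e : ℝ} (he : 0 < e) :
    Tendsto (fun h : ℝ => h ^ e) (𝓝[>] 0) (𝓝 0) := by
  have hcont := (Real.continuousAt_rpow_const 0 e (Or.inr he.le)).tendsto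
  rw [Real.zero_rpow he.ne'] at hcont
  exact hcont.mono_left nhdsWithin_le_nhds

theorem eq_zero_of_continuousAt_of_isLittleO {B : ℝ → ℝ} {α c : ℝ} (hα : 0 < α)
    (hcont : ContinuousAt B 0)
    (hB : (fun t => B t - c * t ^ α) =o[𝓝[>] 0] fun t => t ^ α) : B 0 = 0 := by
  have hpow := tendsto_rpow_nhdsGT_zero hα
  have hlim : Tendsto B (𝓝[>] 0) (𝓝 0) := by
    simpa using (hB.trans_tendsto hpow).add (hpow.const_mul c)
  exact tendsto_nhds_unique (hcont.tendsto.mono_left nhdsWithin_le_nhds) hlim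

theorem HasPrincipalIrregularTerm.hasLocalExpansion {E : Type*} [NormedAddCommGroup E]
    [InnerProductSpace ℝ E] [FiniteDimensional ℝ E] {K : ℝ → ℝ} {L α c : ℝ} (hL : 0 < L)
    (hK : HasPrincipalIrregularTerm K L α c) :
    HasLocalExpansion (fun u : E => K ‖u‖) α c := by
  obtain ⟨A, B, hAB, hAeven, hA, -, hBcont, hBsmooth, hBderiv⟩ := hK.decomposition
  have hBat : ∀ᶠ t in 𝓝[>] 0, ContDiffAt ℝ ∞ B t := by
    filter_upwards [Ioo_mem_nhdsGT hL] with t ht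
    exact (hBsmooth.mono Ioo_subset_Ioc_self).contDiffAt (Ioo_mem_nhds ht.1 ht.2)
  have hBO : ∀ i, iteratedDeriv i B =O[𝓝[>] 0] fun t => t ^ (α - i) := fun i => by
    simpa using (hBderiv i).isBigO.add
      ((isBigO_refl (fun t : ℝ => t ^ (α - i)) _).const_mul_left (fallingFactorial α i * c))
  have hB : (fun t => B t - c * t ^ α) =o[𝓝[>] 0] fun t => t ^ α := by
    simpa [fallingFactorial] using hBderiv 0
  have hB0 : B 0 = 0 := eq_zero_of_continuousAt_of_isLittleO hK.exponent_pos
    (hBcont.continuousAt (Icc_mem_nhds (neg_lt_zero.2 hL) hL)) hB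
  exact ⟨fun u => A ‖u‖, fun u => B ‖u‖, funext fun u => hAB ‖u‖,
    analyticAt_comp_norm (hA 0 (mem_univ _)) hAeven,
    tendsto_norm_nhdsNE_zero.eventually hBat |>.mp <| by
      filter_upwards [self_mem_nhdsWithin] with u hu hBu
      exact ContDiffAt.comp u hBu (contDiffAt_norm ℝ hu),
    isBigO_iteratedFDeriv_comp_norm hBat hBO,
    isLittleO_comp_norm_of_isLittleO hB
      (by rw [hB0, Real.zero_rpow hK.exponent_pos.ne', mul_zero, sub_zero])⟩

theorem IsIsotropicUpToRemainder.exists_hasLocalExpansion {d : ℕ}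
    {C : Fin 2 → Fin 2 → EuclideanSpace ℝ (Fin d) → ℝ} {L : ℝ} {α : Fin 2 → Fin 2 → ℝ}
    (hL : 0 < L) (hC : IsIsotropicUpToRemainder C L α) (k l : Fin 2) :
    ∃ c : ℝ, (k = l → c ≠ 0) ∧ 0 < α k l ∧ (∀ i : ℕ, α k l ≠ 2 * (i : ℝ)) ∧
      HasLocalExpansion (C k l) (α k l) c := by
  obtain ⟨c, K, r, hc, hK, hCK, hr, hsmooth, hderiv⟩ := hC.decomposition k l
  have hsum : C k l = (fun u => K ‖u‖) + r := funext hCK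
  exact ⟨c, hc, hK.exponent_pos, hK.exponent_not_even,
    hsum ▸ (hK.hasLocalExpansion hL).add_remainder hr hsmooth hderiv⟩

end LocalExpansion

section SmallLags

variable {d : ℕ}

theorem rpow_le_rpow_abs_mul_rpow {x y k : ℝ} (hx : 0 < x) (hy : 0 < y) (hxy : x ≤ k * y)
    (hyx : y ≤ k * x) (e : ℝ) : x ^ e ≤ k ^ |e| * y ^ e := by
  have hk : 0 < k := pos_of_mul_pos_left (hx.trans_le hxy) hy.le
  rcases le_total 0 e with he | he
  · rw [abs_of_nonneg he, ← Real.mul_rpow hk.le hy.le]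
    exact Real.rpow_le_rpow hx.le hxy he
  · rw [abs_of_nonpos he, Real.rpow_neg hk.le, ← Real.inv_rpow hk.le,
      ← Real.mul_rpow (inv_nonneg.2 hk.le) hy.le]
    exact Real.rpow_le_rpow_of_nonpos (by positivity) ((inv_mul_le_iff₀ hk).2 hyx) he

theorem isBigO_one_iterate_discreteLaplacian {S : EuclideanSpace ℝ (Fin d) → ℝ} {q : ℕ}
    (hS : ContDiffAt ℝ (2 * q : ℕ) S 0) :
    (fun z : ℝ × EuclideanSpace ℝ (Fin d) => (discreteLaplacian z.1)^[q] S z.2)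
      =O[𝓝[>] 0 ×ˢ 𝓝 0] fun _ => (1 : ℝ) := by
  have hbdd := (hS.continuousAt_iteratedFDeriv le_rfl).norm.eventually (gt_mem_nhds (lt_add_one _))
  obtain ⟨δ, hδ, hball⟩ := Metric.eventually_nhds_iff_ball.1 ((hS.eventually (fun h =>
    ENat.natCast_ne_top _ (WithTop.coe_injective h))).and hbdd)
  refine IsBigO.of_bound (d ^ q * (‖iteratedFDeriv ℝ (2 * q) S 0‖ + 1)) ?_
  filter_upwards [prod_mem_prod (Ioo_mem_nhdsGT (show 0 < δ / (2 * (q + 1)) by positivity))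
    (Metric.ball_mem_nhds 0 (half_pos hδ))] with ⟨h, u⟩ ⟨⟨h0, hhδ⟩, hu⟩
  rw [norm_one, mul_one, Real.norm_eq_abs]
  have hsub : Metric.ball u (δ / 2) ⊆ Metric.ball 0 δ := fun x hx => by
    rw [mem_ball_iff_norm] at hx hu
    rw [mem_ball_zero_iff]
    linarith [norm_add_le (x - u) u, congrArg norm (sub_add_cancel x u), congrArg norm (sub_zero u)]
  refine abs_iterate_discreteLaplacian_le (R := δ / 2) h0.ne' ?_
    (fun x hx => (hball x (hsub hx)).1.contDiffWithinAt) fun x hx => (hball x (hsub hx)).2.le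
  rw [lt_div_iff₀ (by positivity)] at hhδ
  rw [abs_of_pos h0]
  linarith

theorem abs_iterate_discreteLaplacian_le_of_norm_le {R : EuclideanSpace ℝ (Fin d) → ℝ}
    {α C h : ℝ} {q : ℕ} {u : EuclideanSpace ℝ (Fin d)} (hα : 0 < α) (hC : 0 ≤ C) (hh : 0 < h)
    (hu : ‖u‖ ≤ 2 * (q + 1) * h) (hR : ∀ x, ‖x - u‖ ≤ q * h → |R x| ≤ C * ‖x‖ ^ α) :
    |(discreteLaplacian h)^[q] R u| ≤
      (∑ p : Fin q → Fin d × Fin 3, |stencilWeight p|) *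
        (C * (3 * q + 2) ^ α * (2 * q + 3) ^ |α - 2 * q|) * (h + ‖u‖) ^ (α - 2 * q) := by
  have hpow : (1 / h ^ 2) ^ q * (C * ((3 * q + 2) * h) ^ α) =
      C * (3 * q + 2) ^ α * h ^ (α - 2 * q) := by
    have h2q : (2 * q : ℝ) = (2 * q : ℕ) := by push_cast; rfl
    rw [Real.mul_rpow (by positivity) hh.le, h2q, Real.rpow_sub hh, Real.rpow_natCast, one_div,
      inv_pow, ← pow_mul]
    field_simp
  have hcomp : h ^ (α - 2 * q) ≤ (2 * q + 3) ^ |α - 2 * q| * (h + ‖u‖) ^ (α - 2 * q) := by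
    have hu0 := norm_nonneg u
    have hq : (0 : ℝ) ≤ q := q.cast_nonneg
    exact rpow_le_rpow_abs_mul_rpow hh (by positivity) (by nlinarith [hq]) (by linarith) _
  have hsup : ∀ x, ‖x - u‖ ≤ q * |h| → |R x| ≤ C * ((3 * q + 2) * h) ^ α := by
    intro x hx
    rw [abs_of_pos hh] at hx
    refine (hR x hx).trans ?_
    gcongr
    linarith [norm_add_le (x - u) u, congrArg norm (sub_add_cancel x u)]
  refine (abs_iterate_discreteLaplacian_le_of_abs_le hsup).trans ?_
  rw [hpow]
  refine (mul_le_mul_of_nonneg_left (mul_le_mul_of_nonneg_left hcomp (by positivity))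
    (by positivity)).trans_eq (by ring)

theorem abs_iterate_discreteLaplacian_le_of_lt_norm {R : EuclideanSpace ℝ (Fin d) → ℝ}
    {e C h : ℝ} {q : ℕ} {u : EuclideanSpace ℝ (Fin d)} (hC : 0 ≤ C) (hh : 0 < h)
    (hu : 2 * (q + 1) * h < ‖u‖)
    (hsmooth : ∀ x ∈ Metric.ball u (‖u‖ / 2), ContDiffAt ℝ (2 * q : ℕ) R x)
    (hR : ∀ x ∈ Metric.ball u (‖u‖ / 2), ‖iteratedFDeriv ℝ (2 * q) R x‖ ≤ C * ‖x‖ ^ e) :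
    |(discreteLaplacian h)^[q] R u| ≤ d ^ q * (C * 4 ^ |e|) * (h + ‖u‖) ^ e := by
  rw [mul_assoc, mul_assoc]
  have hqh : 0 ≤ q * h := by positivity
  refine abs_iterate_discreteLaplacian_le (R := ‖u‖ / 2) hh.ne' (by rw [abs_of_pos hh]; linarith)
    (fun x hx => (hsmooth x hx).contDiffWithinAt) fun x hx => (hR x hx).trans ?_
  rw [mem_ball_iff_norm] at hx
  have hux : ‖u‖ ≤ ‖x - u‖ + ‖x‖ := norm_sub_rev u x ▸ norm_le_norm_sub_add u x
  have hxu : ‖x‖ ≤ ‖x - u‖ + ‖u‖ := norm_le_norm_sub_add x u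
  gcongr
  exact rpow_le_rpow_abs_mul_rpow (by linarith) (by linarith) (by linarith) (by linarith) e

theorem isBigO_iterate_discreteLaplacian_of_isBigO {R : EuclideanSpace ℝ (Fin d) → ℝ} {α : ℝ}
    {q : ℕ} (hα : 0 < α) (hR : R =O[𝓝 0] fun u => ‖u‖ ^ α)
    (hsmooth : ∀ᶠ u in 𝓝[≠] 0, ContDiffAt ℝ (2 * q : ℕ) R u)
    (hderiv : iteratedFDeriv ℝ (2 * q) R =O[𝓝[≠] 0] fun u => ‖u‖ ^ (α - 2 * q)) :
    (fun z : ℝ × EuclideanSpace ℝ (Fin d) => (discreteLaplacian z.1)^[q] R z.2)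
      =O[𝓝[>] 0 ×ˢ 𝓝 0] fun z => (z.1 + ‖z.2‖) ^ (α - 2 * q) := by
  obtain ⟨C, hC, hRC⟩ := hR.exists_nonneg
  obtain ⟨C', hC', hRC'⟩ := hderiv.exists_nonneg
  obtain ⟨δ, hδ, hnear⟩ := Metric.eventually_nhds_iff_ball.1 hRC.bound
  obtain ⟨δ', hδ', hfar⟩ := Metric.mem_nhdsWithin_iff.1 (hsmooth.and hRC'.bound)
  set A := (∑ p : Fin q → Fin d × Fin 3, |stencilWeight p|) *
    (C * (3 * q + 2) ^ α * (2 * q + 3) ^ |α - 2 * q|)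
  set A' := d ^ q * (C' * 4 ^ |α - 2 * q|)
  refine IsBigO.of_bound (max A A') ?_
  have hδ0 : 0 < min δ δ' := lt_min hδ hδ'
  filter_upwards [prod_mem_prod (Ioo_mem_nhdsGT (show 0 < min δ δ' / (2 * (q + 1)) by positivity))
    (Metric.ball_mem_nhds 0 (half_pos hδ0))] with ⟨h, u⟩ ⟨⟨h0, hhδ⟩, hu⟩
  rw [mem_ball_zero_iff] at hu
  rw [lt_div_iff₀ (by positivity)] at hhδ
  have hpos : 0 ≤ (h + ‖u‖) ^ (α - 2 * q) := by positivity
  rw [Real.norm_of_nonneg hpos, Real.norm_eq_abs]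
  rcases le_or_gt ‖u‖ (2 * (q + 1) * h) with hle | hlt
  · refine (abs_iterate_discreteLaplacian_le_of_norm_le hα hC h0 hle fun x hx => ?_).trans
      (mul_le_mul_of_nonneg_right (le_max_left _ _) hpos)
    have hxδ : ‖x‖ < δ := by
      linarith [norm_le_norm_sub_add x u, min_le_left δ δ']
    simpa [abs_of_nonneg (Real.rpow_nonneg (norm_nonneg x) α)] using
      hnear x (mem_ball_zero_iff.2 hxδ)
  · have hball : ∀ x ∈ Metric.ball u (‖u‖ / 2), x ∈ Metric.ball 0 δ' ∩ {0}ᶜ := fun x hx => by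
      rw [mem_ball_iff_norm] at hx
      refine ⟨mem_ball_zero_iff.2 ?_, ?_⟩
      · linarith [norm_le_norm_sub_add x u, min_le_right δ δ']
      · rintro rfl
        rw [zero_sub, norm_neg] at hx
        linarith [norm_nonneg u]
    refine (abs_iterate_discreteLaplacian_le_of_lt_norm hC' h0 hlt
      (fun x hx => (hfar (hball x hx)).1) fun x hx => ?_).trans
      (mul_le_mul_of_nonneg_right (le_max_right _ _) hpos)
    simpa [abs_of_nonneg (Real.rpow_nonneg (norm_nonneg x) _)] using (hfar (hball x hx)).2

theorem HasLocalExpansion.isBigO_iterate_discreteLaplacian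
    {f : EuclideanSpace ℝ (Fin d) → ℝ} {α c : ℝ} (hf : HasLocalExpansion f α c) (hα : 0 < α)
    (q : ℕ) :
    (fun z : ℝ × EuclideanSpace ℝ (Fin d) => (discreteLaplacian z.1)^[q] f z.2)
      =O[𝓝[>] 0 ×ˢ 𝓝 0] fun z => (z.1 + ‖z.2‖) ^ (-max (2 * q - α) 0) := by
  obtain ⟨S, R, rfl, hS, hRs, hRp, hR⟩ := hf.exists_decomposition
  have hbound : ∀ e, -max (2 * q - α) 0 ≤ e →
      (fun z : ℝ × EuclideanSpace ℝ (Fin d) => (z.1 + ‖z.2‖) ^ e)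
        =O[𝓝[>] 0 ×ˢ 𝓝 0] fun z => (z.1 + ‖z.2‖) ^ (-max (2 * q - α) 0) := fun e he => by
    refine IsBigO.of_bound' ?_
    filter_upwards [prod_mem_prod (Ioo_mem_nhdsGT one_half_pos)
      (Metric.ball_mem_nhds 0 one_half_pos)] with ⟨h, u⟩ ⟨⟨h0, hh⟩, hu⟩
    rw [mem_ball_zero_iff] at hu
    have hpos : 0 < h + ‖u‖ := by positivity
    rw [Real.norm_of_nonneg (by positivity), Real.norm_of_nonneg (by positivity)]
    exact Real.rpow_le_rpow_of_exponent_ge hpos (by linarith) he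
  have hRO : R =O[𝓝 0] fun u => ‖u‖ ^ α := by
    simpa using hR.isBigO.add ((isBigO_refl (fun u => ‖u‖ ^ α) _).const_mul_left c)
  have hsmooth := isBigO_one_iterate_discreteLaplacian (q := q) hS.contDiffAt
  have hirregular := isBigO_iterate_discreteLaplacian_of_isBigO (q := q) hα hRO
    (hRs.mono fun u hu => hu.of_le (WithTop.coe_le_coe.2 le_top)) (by simpa using hRp (2 * q))
  simp only [iterate_discreteLaplacian_add]
  exact (hsmooth.trans (by simpa using hbound 0 (by simp))).add
    (hirregular.trans (hbound _ (by linarith [le_max_left (2 * q - α) 0])))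

end SmallLags

section ScalingLimit

variable {d : ℕ}

theorem tendsto_rpow_neg_mul_comp_smul {E : Type*} [NormedAddCommGroup E] [NormedSpace ℝ E]
    {R : E → ℝ} {α c : ℝ} (hR : (fun u => R u - c * ‖u‖ ^ α) =o[𝓝 0] fun u => ‖u‖ ^ α) (x : E) :
    Tendsto (fun h : ℝ => h ^ (-α) * R (h • x)) (𝓝[>] 0) (𝓝 (c * ‖x‖ ^ α)) := by
  have hsmul : Tendsto (fun h : ℝ => h • x) (𝓝[>] 0) (𝓝 0) :=
    ((continuous_id.smul continuous_const).tendsto' 0 0 (zero_smul ℝ x)).mono_left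
      nhdsWithin_le_nhds
  have hnorm : ∀ᶠ h : ℝ in 𝓝[>] 0, ‖h • x‖ ^ α = h ^ α * ‖x‖ ^ α := by
    filter_upwards [self_mem_nhdsWithin] with h (hh : 0 < h)
    rw [norm_smul, Real.norm_of_nonneg hh.le, Real.mul_rpow hh.le (norm_nonneg x)]
  have hdiff : (fun h : ℝ => R (h • x) - c * ‖h • x‖ ^ α) =o[𝓝[>] 0] fun h : ℝ => h ^ α := by
    refine (hR.comp_tendsto hsmul).trans_isBigO (IsBigO.of_bound (‖x‖ ^ α) ?_)
    filter_upwards [hnorm] with h hh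
    rw [Function.comp_apply, hh, norm_mul, mul_comm,
      Real.norm_of_nonneg (Real.rpow_nonneg (norm_nonneg x) α)]
  have hlim := hdiff.tendsto_div_nhds_zero.add_const (c * ‖x‖ ^ α)
  rw [zero_add] at hlim
  refine hlim.congr' ?_
  filter_upwards [hnorm, self_mem_nhdsWithin] with h hh (h0 : 0 < h)
  have hpow : h ^ α ≠ 0 := (Real.rpow_pos_of_pos h0 α).ne'
  rw [hh, Real.rpow_neg h0.le]
  field_simp
  ring

theorem tendsto_iterate_discreteLaplacian_of_isLittleO {R : EuclideanSpace ℝ (Fin d) → ℝ}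
    {α c : ℝ} (hR : (fun u => R u - c * ‖u‖ ^ α) =o[𝓝 0] fun u => ‖u‖ ^ α) (q : ℕ)
    (u : EuclideanSpace ℝ (Fin d)) :
    Tendsto (fun h : ℝ => h ^ (2 * q - α) * (discreteLaplacian h)^[q] R (h • u)) (𝓝[>] 0)
      (𝓝 (c * (discreteLaplacian 1)^[q] (fun x => ‖x‖ ^ α) u)) := by
  have hprofile : Tendsto (fun h : ℝ => h ^ (-α) • fun x => R (h • x)) (𝓝[>] 0)
      (𝓝 (c • fun x : EuclideanSpace ℝ (Fin d) => ‖x‖ ^ α)) :=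
    tendsto_pi_nhds.2 fun x => tendsto_rpow_neg_mul_comp_smul hR x
  have hlim := tendsto_pi_nhds.1
    (((continuous_iterate_discreteLaplacian (d := d) 1 q).tendsto _).comp hprofile) u
  rw [iterate_discreteLaplacian_smul] at hlim
  refine hlim.congr' ?_
  filter_upwards [self_mem_nhdsWithin] with h (hh : 0 < h)
  have hpow : h ^ (2 * q - α) * (1 / h ^ 2) ^ q = h ^ (-α) := by
    have h2q : (2 * q : ℝ) = (2 * q : ℕ) := by push_cast; rfl
    rw [sub_eq_add_neg, h2q, Real.rpow_add hh, Real.rpow_natCast, one_div, inv_pow, ← pow_mul]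
    field_simp
  rw [Function.comp_apply, iterate_discreteLaplacian_smul, iterate_discreteLaplacian_smul_eq,
    ← mul_assoc, hpow, Pi.smul_apply, smul_eq_mul]

theorem HasLocalExpansion.tendsto_iterate_discreteLaplacian
    {f : EuclideanSpace ℝ (Fin d) → ℝ} {α c : ℝ} (hf : HasLocalExpansion f α c) {q : ℕ}
    (hαq : α < 2 * q) (u : EuclideanSpace ℝ (Fin d)) :
    Tendsto (fun h : ℝ => h ^ (2 * q - α) * (discreteLaplacian h)^[q] f (h • u)) (𝓝[>] 0)
      (𝓝 (c * (discreteLaplacian 1)^[q] (fun x => ‖x‖ ^ α) u)) := by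
  obtain ⟨S, R, rfl, hS, -, -, hR⟩ := hf.exists_decomposition
  have hpow := tendsto_rpow_nhdsGT_zero (sub_pos.2 hαq)
  have hpath : Tendsto (fun h : ℝ => (h, h • u)) (𝓝[>] 0) (𝓝[>] 0 ×ˢ 𝓝 0) :=
    tendsto_id.prodMk (((continuous_id.smul continuous_const).tendsto' 0 0
      (zero_smul ℝ u)).mono_left nhdsWithin_le_nhds)
  have hsmooth : Tendsto (fun h : ℝ => h ^ (2 * q - α) * (discreteLaplacian h)^[q] S (h • u))
      (𝓝[>] 0) (𝓝 0) :=
    hpow.zero_mul_isBoundedUnder_le (((isBigO_one_iff ℝ).1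
      ((isBigO_one_iterate_discreteLaplacian (q := q) hS.contDiffAt).comp_tendsto hpath)))
  have hlim := hsmooth.add (tendsto_iterate_discreteLaplacian_of_isLittleO hR q u)
  rw [zero_add] at hlim
  refine hlim.congr fun h => ?_
  rw [iterate_discreteLaplacian_add, Pi.add_apply, mul_add]

end ScalingLimit

section Nondegeneracy

open scoped ContDiff

theorem exists_eq_natCast_of_analyticAt_of_eventuallyEq_rpow {F : ℝ → ℝ} {a : ℝ}
    (hF : AnalyticAt ℝ F 0) (hFa : ∀ᶠ t in 𝓝[>] 0, F t = t ^ a) : ∃ n : ℕ, a = n := by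
  have hne : ¬ ∀ᶠ t in 𝓝 0, F t = 0 := fun h0 => by
    obtain ⟨t, ht, ht0, htpos⟩ :=
      (hFa.and ((h0.filter_mono nhdsWithin_le_nhds).and self_mem_nhdsWithin)).exists
    exact (Real.rpow_pos_of_pos htpos a).ne' (ht.symm.trans ht0)
  obtain ⟨n, g, hg, hg0, hFg⟩ := hF.exists_eventuallyEq_pow_smul_nonzero_iff.2 hne
  have hlim : Tendsto (fun t : ℝ => t ^ (a - n)) (𝓝[>] 0) (𝓝 (g 0)) := by
    refine (hg.continuousAt.tendsto.mono_left nhdsWithin_le_nhds).congr' ?_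
    filter_upwards [hFa, hFg.filter_mono nhdsWithin_le_nhds, self_mem_nhdsWithin] with t h₁ h₂ ht
    rw [sub_zero, smul_eq_mul, h₁] at h₂
    rw [Real.rpow_sub ht, Real.rpow_natCast, h₂, mul_div_cancel_left₀ _ (pow_ne_zero n ht.ne')]
  refine ⟨n, ?_⟩
  rcases lt_trichotomy a n with hlt | heq | hgt
  · refine absurd hlim (not_tendsto_nhds_of_tendsto_atTop ?_ _)
    exact tendsto_rpow_neg_nhdsGT_zero (sub_neg.2 hlt)
  · exact heq
  · exact absurd (tendsto_nhds_unique hlim (tendsto_rpow_nhdsGT_zero (sub_pos.2 hgt))) hg0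

theorem not_analyticAt_abs_rpow {α : ℝ} (hα : ∀ k : ℕ, α ≠ 2 * k) :
    ¬AnalyticAt ℝ (fun t : ℝ => |t| ^ α) 0 := by
  intro h
  obtain ⟨F, hF, hFα⟩ := exists_analyticAt_eventually_eq_comp_sq h fun t => by rw [abs_neg]
  have hsqrt : Tendsto Real.sqrt (𝓝[>] 0) (𝓝 0) := by
    simpa using Real.continuous_sqrt.continuousAt.tendsto.mono_left
      (nhdsWithin_le_nhds (a := (0 : ℝ)) (s := Ioi 0))
  obtain ⟨n, hn⟩ := exists_eq_natCast_of_analyticAt_of_eventuallyEq_rpow (a := α / 2) hF (by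
    filter_upwards [hsqrt.eventually hFα, self_mem_nhdsWithin] with t ht ht0
    have ht0' : 0 ≤ t := le_of_lt ht0
    rw [Real.sq_sqrt ht0', abs_of_nonneg (Real.sqrt_nonneg t), Real.sqrt_eq_rpow,
      ← Real.rpow_mul ht0'] at ht
    rw [← ht, one_div_mul_eq_div])
  exact hα n (by linarith)

theorem analyticAt_norm_add_smul_rpow {E : Type*} [NormedAddCommGroup E] [InnerProductSpace ℝ E]
    {x : E} (hx : x ≠ 0) (e : E) (α : ℝ) : AnalyticAt ℝ (fun t : ℝ => ‖x + t • e‖ ^ α) 0 := by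
  have hsq : AnalyticAt ℝ (fun t : ℝ => ‖x + t • e‖ ^ 2) 0 := by
    have hcont : ContDiff ℝ ω fun t : ℝ => ‖x + t • e‖ ^ 2 :=
      (contDiff_const.add (contDiff_id.smul contDiff_const)).norm_sq ℝ
    exact hcont.contDiffAt.analyticAt
  have hpos : 0 < ‖x + (0 : ℝ) • e‖ ^ 2 := by simpa using pow_pos (norm_pos_iff.2 hx) 2
  refine (((hsq.log hpos).mul (analyticAt_const (v := α / 2))).rexp).congr ?_
  filter_upwards [hsq.continuousAt.eventually (lt_mem_nhds hpos)] with t ht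
  rw [Function.comp_apply, Pi.mul_apply, ← Real.rpow_def_of_pos ht, ← Real.rpow_natCast,
    ← Real.rpow_mul (norm_nonneg _)]
  congr 1
  push_cast
  ring

variable {d : ℕ}

theorem smul_single_add_stencilOffset_eq_zero_iff {M : ℕ} (g : Fin d)
    (p : Fin M → Fin d × Fin 3) :
    (M : ℝ) • EuclideanSpace.single g (1 : ℝ) + stencilOffset p = 0 ↔ p = fun _ => (g, 1) := by
  constructor
  · intro h
    have hcoord : ∑ i, (1 + if g = (p i).1 then (![1, -1, 0] (p i).2 : ℝ) else 0) = 0 := by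
      simpa [stencilOffset, Finset.sum_add_distrib, Pi.single_apply]
        using congrArg (fun v => v g) h
    have hterm : ∀ a : Fin d × Fin 3, 0 ≤ 1 + (if g = a.1 then (![1, -1, 0] a.2 : ℝ) else 0) ∧
        (1 + (if g = a.1 then (![1, -1, 0] a.2 : ℝ) else 0) = 0 → a = (g, 1)) := by
      rintro ⟨j, k⟩
      rcases eq_or_ne g j with rfl | hgj <;> fin_cases k <;> simp [*]
    funext i
    exact (hterm (p i)).2
      ((Finset.sum_eq_zero_iff_of_nonneg fun i _ => (hterm (p i)).1).1 hcoord i (Finset.mem_univ i))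
  · rintro rfl
    simp [stencilOffset, ← Nat.cast_smul_eq_nsmul ℝ]

/- On the axis through `M e_g` the node `-M e_g` alone reaches the origin, so `Δ₁ ^ M` of
`‖·‖ ^ α` restricts there to `|t| ^ α` plus an analytic function. -/
theorem exists_iterate_discreteLaplacian_norm_rpow_ne_zero (hd : 1 ≤ d) {α : ℝ}
    (hα : ∀ k : ℕ, α ≠ 2 * k) (M : ℕ) :
    ∃ u : EuclideanSpace ℝ (Fin d), (discreteLaplacian 1)^[M] (fun y => ‖y‖ ^ α) u ≠ 0 := by
  by_contra! h
  let g : Fin d := ⟨0, hd⟩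
  let e : EuclideanSpace ℝ (Fin d) := EuclideanSpace.single g 1
  let p₀ : Fin M → Fin d × Fin 3 := fun _ => (g, 1)
  have hrest : AnalyticAt ℝ (fun t : ℝ => -∑ p ∈ Finset.univ.erase p₀,
      stencilWeight p * ‖(M : ℝ) • e + stencilOffset p + t • e‖ ^ α) 0 :=
    (Finset.analyticAt_fun_sum _ fun p hp => analyticAt_const.mul
      (analyticAt_norm_add_smul_rpow (fun h0 => Finset.ne_of_mem_erase hp
        ((smul_single_add_stencilOffset_eq_zero_iff g p).1 h0)) e α)).neg
  refine not_analyticAt_abs_rpow hα (hrest.congr (Eventually.of_forall fun t => ?_))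
  have ht := h ((M : ℝ) • e + t • e)
  simp only [iterate_discreteLaplacian_eq_sum, one_smul, one_pow, div_one, one_mul,
    add_right_comm _ (t • e)] at ht
  rw [← Finset.sum_erase_add _ _ (Finset.mem_univ p₀),
    (smul_single_add_stencilOffset_eq_zero_iff g p₀).2 rfl, zero_add, norm_smul,
    PiLp.norm_single, norm_one, mul_one, Real.norm_eq_abs] at ht
  have hweight : stencilWeight p₀ = 1 := by simp [p₀, stencilWeight]
  rw [hweight, one_mul] at ht
  linarith

end Nondegeneracy

section GaussianMoments

theorem deriv_exp_mul_sq_div_two (v : ℝ) :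
    deriv (fun t => Real.exp (v * t ^ 2 / 2)) = fun t => t * (v * Real.exp (v * t ^ 2 / 2)) := by
  funext t
  rw [deriv_exp (by fun_prop)]
  simp
  ring

theorem integral_pow_add_two_gaussianReal (v : NNReal) (n : ℕ) :
    ∫ x, x ^ (n + 2) ∂gaussianReal 0 v = (n + 1) * v * ∫ x, x ^ n ∂gaussianReal 0 v := by
  have hmoment (k : ℕ) : ∫ x, x ^ k ∂gaussianReal 0 v =
      iteratedDeriv k (fun t => Real.exp (v * t ^ 2 / 2)) 0 := by
    have h := iteratedDeriv_mgf_zero (X := id) (μ := gaussianReal 0 v)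
      (by simp [integrableExpSet_id_gaussianReal]) k
    simpa [mgf_id_gaussianReal] using h.symm
  rw [hmoment, hmoment, iteratedDeriv_succ', deriv_exp_mul_sq_div_two,
    iteratedDeriv_fun_mul (by fun_prop) (by fun_prop), Finset.sum_eq_single 1]
  · simp [iteratedDeriv_fun_id]
    ring
  · intro i _ hi
    simp [iteratedDeriv_fun_id_zero, hi]
  · simp

variable {Ω : Type*} [MeasurableSpace Ω] {P : Measure Ω}

theorem integral_pow_four_of_hasGaussianLaw {X : Ω → ℝ} (hX : HasGaussianLaw X P)
    (hX0 : ∫ ω, X ω ∂P = 0) : ∫ ω, X ω ^ 4 ∂P = 3 * Var[X; P] ^ 2 := by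
  have hmap (k : ℕ) : ∫ ω, X ω ^ k ∂P = ∫ x, x ^ k ∂gaussianReal 0 Var[X; P].toNNReal := by
    rw [← hX0, ← hX.map_eq_gaussianReal, integral_map hX.aemeasurable (by fun_prop)]
  rw [hmap, integral_pow_add_two_gaussianReal, integral_pow_add_two_gaussianReal]
  have := hX.isProbabilityMeasure
  simp [variance_nonneg]
  ring

theorem memLp_two_mul_of_hasGaussianLaw {X Y : Ω → ℝ} (hX : HasGaussianLaw X P)
    (hY : HasGaussianLaw Y P) : MemLp (X * Y) 2 P := by
  have : ENNReal.HolderTriple 4 4 2 := ⟨by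
    rw [← two_mul, show (4 : ENNReal) = 2 * 2 by norm_num,
      ENNReal.mul_inv (.inl two_ne_zero) (.inl ENNReal.ofNat_ne_top), ← mul_assoc,
      ENNReal.mul_inv_cancel two_ne_zero ENNReal.ofNat_ne_top, one_mul]⟩
  exact (hY.memLp (p := 4) ENNReal.ofNat_ne_top).mul (hX.memLp (p := 4) ENNReal.ofNat_ne_top)

theorem covariance_sq_sq_of_hasGaussianLaw {X Y : Ω → ℝ}
    (hXY : HasGaussianLaw (fun ω => (X ω, Y ω)) P)
    (hX0 : ∫ ω, X ω ∂P = 0) (hY0 : ∫ ω, Y ω ∂P = 0) :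
    cov[X ^ 2, Y ^ 2; P] = 2 * cov[X, Y; P] ^ 2 := by
  have hX := hXY.fst
  have hY := hXY.snd
  have := hX.isProbabilityMeasure
  have hfour {Z : Ω → ℝ} (hZ : HasGaussianLaw Z P) : Integrable (fun ω => Z ω ^ 4) P := by
    simpa [Even.pow_abs (show Even 4 by decide)] using
      (hZ.memLp (p := (4 : ℕ)) (by simp)).integrable_norm_pow
  have hadd := integral_pow_four_of_hasGaussianLaw hXY.fun_add
    (by rw [integral_add hX.integrable hY.integrable, hX0, hY0, add_zero])
  have hsub := integral_pow_four_of_hasGaussianLaw hXY.fun_sub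
    (by rw [integral_sub hX.integrable hY.integrable, hX0, hY0, sub_zero])
  rw [variance_fun_add hX.memLp_two hY.memLp_two] at hadd
  rw [variance_fun_sub hX.memLp_two hY.memLp_two] at hsub
  have hpolar : (X ^ 2 * Y ^ 2 : Ω → ℝ) = fun ω => (1 / 12 : ℝ) *
      ((X ω + Y ω) ^ 4 + (X ω - Y ω) ^ 4 - 2 * (X ω ^ 4 + Y ω ^ 4)) := by
    funext ω
    simp only [Pi.mul_apply, Pi.pow_apply]
    ring
  have hsq {Z : Ω → ℝ} (hZ : HasGaussianLaw Z P) (hZ0 : ∫ ω, Z ω ∂P = 0) :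
      ∫ ω, (Z ^ 2) ω ∂P = Var[Z; P] := by
    rw [variance_of_integral_eq_zero hZ.aemeasurable hZ0]
    rfl
  rw [covariance_eq_sub (sq X ▸ memLp_two_mul_of_hasGaussianLaw hX hX)
    (sq Y ▸ memLp_two_mul_of_hasGaussianLaw hY hY), hsq hX hX0, hsq hY hY0, hpolar,
    integral_const_mul, integral_sub ((hfour hXY.fun_add).fun_add (hfour hXY.fun_sub))
      (((hfour hX).fun_add (hfour hY)).const_mul 2), integral_const_mul,
    integral_add (hfour hXY.fun_add) (hfour hXY.fun_sub), integral_add (hfour hX) (hfour hY),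
    hadd, hsub, integral_pow_four_of_hasGaussianLaw hX hX0,
    integral_pow_four_of_hasGaussianLaw hY hY0]
  ring

theorem isGaussianProcess_fun_sum_mul {S T ι : Type*} [Fintype ι] {Z : T → Ω → ℝ}
    (hZ : IsGaussianProcess Z P) (a : S → ι → ℝ) (t : S → ι → T) :
    IsGaussianProcess (fun s ω => ∑ i, a s i * Z (t s i) ω) P := by
  classical
  refine hZ.of_isGaussianProcess fun s => ⟨Finset.univ.image (t s),
    ∑ i, a s i • ContinuousLinearMap.proj ⟨t s i, by simp⟩, fun ω => ?_⟩
  simp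

theorem covariance_mul_mul_of_isGaussianProcess {T : Type*} {Z : T → Ω → ℝ}
    (hZ : IsGaussianProcess Z P) (hZ0 : ∀ t, ∫ ω, Z t ω ∂P = 0) (a b c e : T) :
    cov[Z a * Z b, Z c * Z e; P] =
      cov[Z a, Z c; P] * cov[Z b, Z e; P] + cov[Z a, Z e; P] * cov[Z b, Z c; P] := by
  have := hZ.isProbabilityMeasure
  have hpolar (s t : T) : Z s * Z t = (1 / 4 : ℝ) • ((Z s + Z t) ^ 2 - (Z s - Z t) ^ 2) := by
    funext ω
    simp only [Pi.mul_apply, Pi.smul_apply, Pi.sub_apply, Pi.add_apply, Pi.pow_apply, smul_eq_mul]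
    ring
  have hL (t : T) : MemLp (Z t) 2 P := (hZ.hasGaussianLaw_eval t).memLp_two
  have hadd (s t : T) : MemLp ((Z s + Z t) ^ 2) 2 P :=
    sq (Z s + Z t) ▸ memLp_two_mul_of_hasGaussianLaw hZ.hasGaussianLaw_add hZ.hasGaussianLaw_add
  have hsub (s t : T) : MemLp ((Z s - Z t) ^ 2) 2 P :=
    sq (Z s - Z t) ▸ memLp_two_mul_of_hasGaussianLaw hZ.hasGaussianLaw_sub hZ.hasGaussianLaw_sub
  have hadd0 (s t : T) : ∫ ω, (Z s + Z t) ω ∂P = 0 := by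
    simp [integral_add ((hL s).integrable one_le_two) ((hL t).integrable one_le_two), hZ0]
  have hsub0 (s t : T) : ∫ ω, (Z s - Z t) ω ∂P = 0 := by
    simp [integral_sub ((hL s).integrable one_le_two) ((hL t).integrable one_le_two), hZ0]
  have hpair (ε δ : ℝ) : HasGaussianLaw
      (fun ω => (Z a ω + ε * Z b ω, Z c ω + δ * Z e ω)) P := by
    simpa using (isGaussianProcess_fun_sum_mul hZ ![![1, ε], ![1, δ]]
      ![![a, b], ![c, e]]).hasGaussianLaw_prodMk (s := 0) (t := 1)
  rw [hpolar, hpolar, covariance_smul_left, covariance_smul_right,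
    covariance_sub_sub (hadd a b) (hsub a b) (hadd c e) (hsub c e),
    covariance_sq_sq_of_hasGaussianLaw (by simpa using hpair 1 1) (hadd0 a b) (hadd0 c e),
    covariance_sq_sq_of_hasGaussianLaw (by simpa [← sub_eq_add_neg] using hpair 1 (-1))
      (hadd0 a b) (hsub0 c e),
    covariance_sq_sq_of_hasGaussianLaw (by simpa [← sub_eq_add_neg] using hpair (-1) 1)
      (hsub0 a b) (hadd0 c e),
    covariance_sq_sq_of_hasGaussianLaw (by simpa [← sub_eq_add_neg] using hpair (-1) (-1))
      (hsub0 a b) (hsub0 c e)]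
  simp only [covariance_add_left, covariance_sub_left, covariance_add_right, covariance_sub_right,
    hL, MemLp.add, MemLp.sub]
  ring

end GaussianMoments

section LaplacianField

variable {d : ℕ}

theorem iterate_discreteLaplacian_comp_sub_right (h : ℝ) (M : ℕ)
    (f : EuclideanSpace ℝ (Fin d) → ℝ) (t : EuclideanSpace ℝ (Fin d)) :
    (discreteLaplacian h)^[M] (fun s => f (s - t)) =
      fun s => (discreteLaplacian h)^[M] f (s - t) := by
  funext s
  simp only [iterate_discreteLaplacian_eq_sum, add_sub_right_comm]

theorem iterate_discreteLaplacian_comp_sub_left (h : ℝ) (M : ℕ)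
    (f : EuclideanSpace ℝ (Fin d) → ℝ) (s : EuclideanSpace ℝ (Fin d)) :
    (discreteLaplacian h)^[M] (fun t => f (s - t)) =
      fun t => (discreteLaplacian h)^[M] f (s - t) := by
  refine (Function.Semiconj.iterate_right
    (f := fun f : EuclideanSpace ℝ (Fin d) → ℝ => fun t => f (s - t)) (fun f => ?_) M f).symm
  funext t
  simp only [discreteLaplacian]
  congr! 2 with g
  rw [show s - (t + h • EuclideanSpace.single g 1) = s - t - h • EuclideanSpace.single g 1 by abel,
    show s - (t - h • EuclideanSpace.single g 1) = s - t + h • EuclideanSpace.single g 1 by abel,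
    add_comm (f _)]

variable {Ω : Type*} [MeasurableSpace Ω] {P : Measure Ω}
  {U V : EuclideanSpace ℝ (Fin d) → Ω → ℝ}

theorem memLp_iterate_discreteLaplacian {p : ENNReal} (hU : ∀ t, MemLp (U t) p P) (h : ℝ) (M : ℕ)
    (s : EuclideanSpace ℝ (Fin d)) :
    MemLp (fun ω => (discreteLaplacian h)^[M] (fun t => U t ω) s) p P := by
  simp only [iterate_discreteLaplacian_eq_sum]
  exact (memLp_finsetSum _ fun _ _ => (hU _).const_mul _).const_mul _

theorem integral_iterate_discreteLaplacian (hU : ∀ t, Integrable (U t) P) (h : ℝ) (M : ℕ)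
    (s : EuclideanSpace ℝ (Fin d)) :
    ∫ ω, (discreteLaplacian h)^[M] (fun t => U t ω) s ∂P =
      (discreteLaplacian h)^[M] (fun t => ∫ ω, U t ω ∂P) s := by
  simp only [iterate_discreteLaplacian_eq_sum]
  rw [integral_const_mul, integral_finsetSum _ fun _ _ => (hU _).const_mul _]
  simp only [integral_const_mul]

theorem covariance_iterate_discreteLaplacian_left [IsFiniteMeasure P] (hU : ∀ t, MemLp (U t) 2 P)
    {Y : Ω → ℝ} (hY : MemLp Y 2 P) (h : ℝ) (M : ℕ) (s : EuclideanSpace ℝ (Fin d)) :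
    cov[fun ω => (discreteLaplacian h)^[M] (fun t => U t ω) s, Y; P] =
      (discreteLaplacian h)^[M] (fun t => cov[U t, Y; P]) s := by
  simp only [iterate_discreteLaplacian_eq_sum]
  rw [covariance_const_mul_left, covariance_fun_sum_left (fun _ => (hU _).const_mul _) hY]
  simp only [covariance_const_mul_left]

theorem covariance_iterate_discreteLaplacian_of_stationary [IsFiniteMeasure P]
    (hU : ∀ t, MemLp (U t) 2 P) (hV : ∀ t, MemLp (V t) 2 P) {f : EuclideanSpace ℝ (Fin d) → ℝ}
    (hf : ∀ s t, cov[U s, V t; P] = f (s - t)) (h : ℝ) (M N : ℕ)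
    (s t : EuclideanSpace ℝ (Fin d)) :
    cov[fun ω => (discreteLaplacian h)^[M] (fun x => U x ω) s,
      fun ω => (discreteLaplacian h)^[N] (fun y => V y ω) t; P] =
      (discreteLaplacian h)^[M + N] f (s - t) := by
  have hinner (x : EuclideanSpace ℝ (Fin d)) :
      cov[U x, fun ω => (discreteLaplacian h)^[N] (fun y => V y ω) t; P] =
        (discreteLaplacian h)^[N] f (x - t) := by
    rw [covariance_comm, covariance_iterate_discreteLaplacian_left hV (hU x)]
    simp only [covariance_comm (V _), hf]
    rw [iterate_discreteLaplacian_comp_sub_left]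
  rw [covariance_iterate_discreteLaplacian_left hU (memLp_iterate_discreteLaplacian hV h N t)]
  simp only [hinner]
  rw [iterate_discreteLaplacian_comp_sub_right, Function.iterate_add_apply]

theorem isGaussianProcess_iterate_discreteLaplacian {κ : Type*}
    {Z : κ × EuclideanSpace ℝ (Fin d) → Ω → ℝ} (hZ : IsGaussianProcess Z P) (h : ℝ) (M : ℕ) :
    IsGaussianProcess (fun q : κ × EuclideanSpace ℝ (Fin d) => fun ω =>
      (discreteLaplacian h)^[M] (fun t => Z (q.1, t) ω) q.2) P := by
  simp only [iterate_discreteLaplacian_eq_sum, Finset.mul_sum, ← mul_assoc]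
  exact isGaussianProcess_fun_sum_mul hZ _ fun (q : κ × _) p => (q.1, q.2 + h • stencilOffset p)

/-- The `m`-th discrete Laplacian with step `h` of the `k`-th component of the field `(X, W)`. -/
noncomputable def laplacianField (X W : EuclideanSpace ℝ (Fin d) → Ω → ℝ) (m : ℕ) (h : ℝ)
    (k : Fin 2) (s : EuclideanSpace ℝ (Fin d)) (ω : Ω) : ℝ :=
  (discreteLaplacian h)^[m] (fun t => ![X, W] k t ω) s

namespace IsStationaryGRF

variable {X W : EuclideanSpace ℝ (Fin d) → Ω → ℝ} {C : Fin 2 → Fin 2 → EuclideanSpace ℝ (Fin d) → ℝ}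

theorem isGaussianProcess_laplacianField (hZ : IsStationaryGRF P X W C) (m : ℕ) (h : ℝ) :
    IsGaussianProcess (fun q : Fin 2 × EuclideanSpace ℝ (Fin d) =>
      laplacianField X W m h q.1 q.2) P :=
  isGaussianProcess_iterate_discreteLaplacian hZ.gaussian h m

theorem memLp_two (hZ : IsStationaryGRF P X W C) (k : Fin 2) (s : EuclideanSpace ℝ (Fin d)) :
    MemLp (![X, W] k s) 2 P :=
  (hZ.gaussian.hasGaussianLaw_eval (k, s)).memLp_two

theorem integral_laplacianField (hZ : IsStationaryGRF P X W C) {m : ℕ} (hm : m ≠ 0) (h : ℝ)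
    (k : Fin 2) (s : EuclideanSpace ℝ (Fin d)) : ∫ ω, laplacianField X W m h k s ω ∂P = 0 := by
  have := hZ.gaussian.isProbabilityMeasure
  obtain ⟨μ, hμ⟩ := hZ.mean k
  refine (integral_iterate_discreteLaplacian
    (fun t => (hZ.memLp_two k t).integrable one_le_two) h m s).trans ?_
  simp only [hμ]
  rw [iterate_discreteLaplacian_const hm, Pi.zero_apply]

theorem covariance_laplacianField (hZ : IsStationaryGRF P X W C) (m : ℕ) (h : ℝ) (k l : Fin 2)
    (s t : EuclideanSpace ℝ (Fin d)) :
    cov[laplacianField X W m h k s, laplacianField X W m h l t; P] =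
      (discreteLaplacian h)^[2 * m] (C k l) (s - t) := by
  have := hZ.gaussian.isProbabilityMeasure
  rw [two_mul]
  refine covariance_iterate_discreteLaplacian_of_stationary (hZ.memLp_two k) (hZ.memLp_two l)
    (fun s t => ?_) h m m s t
  rw [← hZ.cov k l t (s - t), add_sub_cancel]

theorem integral_laplacianField_mul (hZ : IsStationaryGRF P X W C) {m : ℕ} (hm : m ≠ 0) (h : ℝ)
    (k l : Fin 2) (s t : EuclideanSpace ℝ (Fin d)) :
    ∫ ω, laplacianField X W m h k s ω * laplacianField X W m h l t ω ∂P =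
      (discreteLaplacian h)^[2 * m] (C k l) (s - t) := by
  simp [← hZ.covariance_laplacianField, covariance, hZ.integral_laplacianField hm]

theorem memLp_two_laplacianField_mul (hZ : IsStationaryGRF P X W C) (m : ℕ) (h : ℝ) (k l : Fin 2)
    (s t : EuclideanSpace ℝ (Fin d)) :
    MemLp (fun ω => laplacianField X W m h k s ω * laplacianField X W m h l t ω) 2 P :=
  memLp_two_mul_of_hasGaussianLaw
    ((hZ.isGaussianProcess_laplacianField m h).hasGaussianLaw_eval (k, s))
    ((hZ.isGaussianProcess_laplacianField m h).hasGaussianLaw_eval (l, t))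

theorem covariance_laplacianField_mul (hZ : IsStationaryGRF P X W C) {m : ℕ} (hm : m ≠ 0) (h : ℝ)
    (k l : Fin 2) (s t : EuclideanSpace ℝ (Fin d)) :
    cov[fun ω => laplacianField X W m h k s ω * laplacianField X W m h l s ω,
      fun ω => laplacianField X W m h k t ω * laplacianField X W m h l t ω; P] =
      (discreteLaplacian h)^[2 * m] (C k k) (s - t) *
          (discreteLaplacian h)^[2 * m] (C l l) (s - t) +
        (discreteLaplacian h)^[2 * m] (C k l) (s - t) *
          (discreteLaplacian h)^[2 * m] (C l k) (s - t) := by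
  simp only [← hZ.covariance_laplacianField]
  exact covariance_mul_mul_of_isGaussianProcess (hZ.isGaussianProcess_laplacianField m h)
    (fun q => hZ.integral_laplacianField hm h q.1 q.2) (k, s) (l, s) (k, t) (l, t)

theorem abs_iterate_discreteLaplacian_le (hZ : IsStationaryGRF P X W C) (m : ℕ) (h : ℝ)
    (k : Fin 2) (u : EuclideanSpace ℝ (Fin d)) :
    |(discreteLaplacian h)^[2 * m] (C k k) u| ≤ (discreteLaplacian h)^[2 * m] (C k k) 0 := by
  have := hZ.gaussian.isProbabilityMeasure
  have hL (s : EuclideanSpace ℝ (Fin d)) : MemLp (laplacianField X W m h k s) 2 P :=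
    memLp_iterate_discreteLaplacian (hZ.memLp_two k) h m s
  have hvar (s : EuclideanSpace ℝ (Fin d)) : Var[laplacianField X W m h k s; P] =
      (discreteLaplacian h)^[2 * m] (C k k) 0 := by
    rw [← covariance_self (hL s).aemeasurable, hZ.covariance_laplacianField, sub_self]
  have hcov := hZ.covariance_laplacianField m h k k u 0
  rw [sub_zero] at hcov
  have hadd := variance_add (hL u) (hL 0)
  have hsub := variance_sub (hL u) (hL 0)
  rw [hvar, hvar, hcov] at hadd hsub
  rw [abs_le]
  constructor <;>
    linarith [variance_nonneg (laplacianField X W m h k u + laplacianField X W m h k 0) P,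
      variance_nonneg (laplacianField X W m h k u - laplacianField X W m h k 0) P]

end IsStationaryGRF

end LaplacianField

section BlockVariance

variable {Ω ι κ : Type*} [MeasurableSpace Ω] {P : Measure Ω} [IsProbabilityMeasure P]

theorem variance_fun_sum_le_card_mul (s : Finset ι) {Y : ι → Ω → ℝ}
    (hY : ∀ i ∈ s, MemLp (Y i) 2 P) :
    Var[fun ω => ∑ i ∈ s, Y i ω; P] ≤ s.card * ∑ i ∈ s, Var[Y i; P] := by
  have hsum : MemLp (fun ω => ∑ i ∈ s, Y i ω) 2 P := memLp_finsetSum _ hY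
  rw [variance_eq_integral hsum.aemeasurable, Finset.sum_congr rfl fun i hi =>
    variance_eq_integral (hY i hi).aemeasurable, ← integral_finsetSum, ← integral_const_mul]
  · refine integral_mono (hsum.sub (memLp_const _)).integrable_sq ?_ fun ω => ?_
    · exact (integrable_finsetSum _ fun i hi =>
        ((hY i hi).sub (memLp_const _)).integrable_sq).const_mul _
    · beta_reduce
      rw [integral_finsetSum _ fun i hi => (hY i hi).integrable one_le_two,
        ← Finset.sum_sub_distrib]
      exact sq_sum_le_card_mul_sum_sq
  · exact fun i hi => ((hY i hi).sub (memLp_const _)).integrable_sq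

theorem variance_fun_sum_le_of_abs_covariance_fiber_le {s : Finset ι} {t : Finset κ} {b : ι → κ}
    (hb : ∀ i ∈ s, b i ∈ t) {Y : ι → Ω → ℝ} (hY : ∀ i ∈ s, MemLp (Y i) 2 P) {F : ι → ι → ℝ}
    (hF₀ : ∀ i j, 0 ≤ F i j) (hF : ∀ i ∈ s, ∀ j ∈ s, b i = b j → |cov[Y i, Y j; P]| ≤ F i j) :
    Var[fun ω => ∑ i ∈ s, Y i ω; P] ≤ t.card * ∑ i ∈ s, ∑ j ∈ s, F i j := by
  classical
  have hfiber : (fun ω => ∑ i ∈ s, Y i ω) = fun ω => ∑ k ∈ t, ∑ i ∈ s with b i = k, Y i ω := by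
    funext ω
    exact (Finset.sum_fiberwise_of_maps_to hb _).symm
  have hY' : ∀ k, ∀ i ∈ s.filter (b · = k), MemLp (Y i) 2 P := fun k i hi =>
    hY i (Finset.mem_filter.1 hi).1
  rw [hfiber]
  refine (variance_fun_sum_le_card_mul t fun k _ => memLp_finsetSum _ (hY' k)).trans ?_
  refine mul_le_mul_of_nonneg_left ?_ (Nat.cast_nonneg _)
  rw [← Finset.sum_fiberwise_of_maps_to hb]
  refine Finset.sum_le_sum fun k _ => ?_
  rw [← covariance_self (memLp_finsetSum _ (hY' k)).aemeasurable,
    covariance_fun_sum_fun_sum' (hY' k) (hY' k)]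
  refine Finset.sum_le_sum fun i hi => ?_
  rw [Finset.mem_filter] at hi
  calc ∑ j ∈ s with b j = k, cov[Y i, Y j; P] ≤ ∑ j ∈ s with b j = k, F i j := by
        refine Finset.sum_le_sum fun j hj => ?_
        rw [Finset.mem_filter] at hj
        exact (le_abs_self _).trans (hF i hi.1 j hj.1 (hi.2.trans hj.2.symm))
    _ ≤ ∑ j ∈ s, F i j :=
        Finset.sum_le_sum_of_subset_of_nonneg (Finset.filter_subset _ _) fun _ _ _ => hF₀ _ _

end BlockVariance

section ConvergenceInProbability

variable {Ω ι : Type*} [MeasurableSpace Ω] {P : Measure Ω} {l : Filter ι}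

theorem tendstoInMeasure_of_tendsto_integral_of_tendsto_variance [IsFiniteMeasure P]
    {U : ι → Ω → ℝ} {c : ℝ} (hU : ∀ i, MemLp (U i) 2 P)
    (hmean : Tendsto (fun i => ∫ ω, U i ω ∂P) l (𝓝 c))
    (hvar : Tendsto (fun i => Var[U i; P]) l (𝓝 0)) :
    TendstoInMeasure P U l (fun _ => c) := by
  rw [tendstoInMeasure_iff_dist]
  intro ε hε
  have hbound : Tendsto (fun i => ENNReal.ofReal (Var[U i; P] / (ε / 2) ^ 2)) l (𝓝 0) := by
    simpa using ENNReal.tendsto_ofReal (hvar.div_const ((ε / 2) ^ 2))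
  refine tendsto_of_tendsto_of_tendsto_of_le_of_le' tendsto_const_nhds hbound
    (Eventually.of_forall fun _ => zero_le) ?_
  filter_upwards [Metric.tendsto_nhds.1 hmean (ε / 2) (half_pos hε)] with i hi
  refine (measure_mono fun ω (hω : ε ≤ dist (U i ω) c) => ?_).trans
    (meas_ge_le_variance_div_sq (hU i) (half_pos hε))
  have htriangle := dist_triangle (U i ω) (∫ ω, U i ω ∂P) c
  rw [Set.mem_ofPred_eq, ← Real.dist_eq]
  linarith

theorem tendstoInMeasure_of_continuousAt₂ {A B G : Type*} [PseudoMetricSpace A]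
    [PseudoMetricSpace B] [PseudoMetricSpace G] {U : ι → Ω → A} {V : ι → Ω → B} {a : A} {b : B}
    {f : A × B → G} (hf : ContinuousAt f (a, b)) (hU : TendstoInMeasure P U l (fun _ => a))
    (hV : TendstoInMeasure P V l (fun _ => b)) :
    TendstoInMeasure P (fun i ω => f (U i ω, V i ω)) l (fun _ => f (a, b)) := by
  rw [tendstoInMeasure_iff_dist] at hU hV ⊢
  intro ε hε
  obtain ⟨δ, hδ, hfδ⟩ := Metric.continuousAt_iff.1 hf ε hε
  have hbound := (hU δ hδ).add (hV δ hδ)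
  rw [add_zero] at hbound
  refine tendsto_of_tendsto_of_tendsto_of_le_of_le tendsto_const_nhds hbound
    (fun _ => zero_le) fun i => ?_
  refine (measure_mono fun ω (hω : ε ≤ dist _ _) => ?_).trans (measure_union_le _ _)
  by_contra hfar
  simp only [mem_union, Set.mem_ofPred_eq, not_or, not_le] at hfar
  exact (hfδ (by simpa only [Prod.dist_eq, max_lt_iff] using hfar)).not_ge hω

theorem tendstoInMeasure_map_of_comp {S : Type*} [MeasurableSpace S] {φ : Ω → S}
    (hφ : Measurable φ) {T : ι → S → ℝ} (hT : ∀ i, Measurable (T i)) {c : ℝ}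
    (h : TendstoInMeasure P (fun i ω => T i (φ ω)) l (fun _ => c)) :
    TendstoInMeasure (P.map φ) T l (fun _ => c) := by
  intro ε hε
  refine (h ε hε).congr fun i => ?_
  rw [Measure.map_apply hφ (measurableSet_le measurable_const ((hT i).edist measurable_const)),
    preimage_ofPred_eq]

end ConvergenceInProbability

section LatticeSums

theorem sum_range_one_add_rpow_neg_le {θ : ℝ} (hθ₀ : 0 ≤ θ) (hθ₁ : θ < 1) (n : ℕ) :
    ∑ i ∈ Finset.range n, (1 + (i : ℝ)) ^ (-θ) ≤ (n : ℝ) ^ (1 - θ) / (1 - θ) := by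
  have hθ : 0 < 1 - θ := by linarith
  induction n with
  | zero => simp [Real.zero_rpow hθ.ne']
  | succ n ih =>
    rw [Finset.sum_range_succ]
    refine (add_le_add_left ih _).trans ?_
    rw [div_add' _ _ _ hθ.ne', div_le_div_iff_of_pos_right hθ]
    push_cast
    have hx : (0 : ℝ) < n + 1 := by positivity
    have bernoulli := rpow_one_add_le_one_add_mul_self (s := -1 / (n + 1 : ℝ)) (by
      rw [le_div_iff₀ hx]; linarith [(Nat.cast_nonneg n : (0 : ℝ) ≤ n)]) hθ.le (by linarith)
    have hratio : (1 + -1 / (n + 1 : ℝ)) = n / (n + 1) := by field_simp; ring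
    rw [hratio, Real.div_rpow (Nat.cast_nonneg n) hx.le, div_le_iff₀ (by positivity)] at bernoulli
    refine (add_le_add_left bernoulli _).trans (le_of_eq ?_)
    rw [add_comm (1 : ℝ) (n : ℝ), Real.rpow_sub hx, Real.rpow_neg hx.le, Real.rpow_one]
    have := (Real.rpow_pos_of_pos hx θ).ne'
    field_simp
    ring

theorem sum_range_one_add_abs_sub_rpow_neg_le {θ : ℝ} (hθ₀ : 0 ≤ θ) (hθ₁ : θ < 1) {n a : ℕ}
    (ha : a ≤ n) :
    ∑ b ∈ Finset.range (n + 1), (1 + |(a : ℝ) - b|) ^ (-θ) ≤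
      2 / (1 - θ) * ((n : ℝ) + 1) ^ (1 - θ) := by
  set f : ℕ → ℝ := fun i => (1 + (i : ℝ)) ^ (-θ)
  have hf₀ : ∀ i, 0 ≤ f i := fun i => by positivity
  have hS := sum_range_one_add_rpow_neg_le hθ₀ hθ₁ (n + 1)
  have hleft : ∑ b ∈ Finset.range (a + 1), (1 + |(a : ℝ) - b|) ^ (-θ) ≤
      ∑ i ∈ Finset.range (n + 1), f i := by
    have hreflect : ∑ b ∈ Finset.range (a + 1), (1 + |(a : ℝ) - b|) ^ (-θ) =
        ∑ b ∈ Finset.range (a + 1), f (a + 1 - 1 - b) := by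
      refine Finset.sum_congr rfl fun b hb => ?_
      have hba : b ≤ a := Nat.lt_succ_iff.1 (Finset.mem_range.1 hb)
      simp only [f, add_tsub_cancel_right]
      rw [Nat.cast_sub hba, abs_of_nonneg (sub_nonneg.2 (by exact_mod_cast hba))]
    rw [hreflect, Finset.sum_range_reflect]
    exact Finset.sum_le_sum_of_subset_of_nonneg
      (Finset.range_subset_range.2 (Nat.succ_le_succ ha)) fun _ _ _ => hf₀ _
  have hright : ∑ b ∈ Finset.Ico (a + 1) (n + 1), (1 + |(a : ℝ) - b|) ^ (-θ) ≤
      ∑ i ∈ Finset.range (n + 1), f i := by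
    rw [Finset.sum_Ico_eq_sum_range]
    refine (Finset.sum_le_sum fun i _ => ?_).trans (Finset.sum_le_sum_of_subset_of_nonneg
      (Finset.range_subset_range.2 (Nat.sub_le _ (a + 1))) fun _ _ _ => hf₀ _)
    refine Real.rpow_le_rpow_of_nonpos (by positivity) ?_ (by linarith)
    rw [abs_sub_comm]
    push_cast
    linarith [le_abs_self ((a + 1 + i : ℝ) - a)]
  rw [← Finset.sum_range_add_sum_Ico _ (Nat.succ_le_succ ha)]
  calc _ ≤ ((n + 1 : ℕ) : ℝ) ^ (1 - θ) / (1 - θ) + ((n + 1 : ℕ) : ℝ) ^ (1 - θ) / (1 - θ) :=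
        add_le_add (hleft.trans hS) (hright.trans hS)
    _ = _ := by push_cast; ring

end LatticeSums

section Grid

variable {d m n : ℕ}

theorem mem_gridInterior {j : Fin d → ℕ} :
    j ∈ gridInterior d n m ↔ ∀ g, m ≤ j g ∧ j g ≤ n - m := by
  simp [gridInterior, Fintype.mem_piFinset]

theorem le_of_mem_gridInterior {j : Fin d → ℕ} (hj : j ∈ gridInterior d n m) (g : Fin d) :
    j g ≤ n :=
  (mem_gridInterior.1 hj g).2.trans (Nat.sub_le _ _)

theorem card_gridInterior (d n m : ℕ) : (gridInterior d n m).card = (n - m + 1 - m) ^ d := by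
  simp [gridInterior, Fintype.card_piFinset]

theorem card_gridInterior_pos (hn : 2 * m ≤ n) : 0 < (gridInterior d n m).card := by
  rw [card_gridInterior]
  exact Nat.pow_pos (by omega)

theorem half_pow_le_card_gridInterior (hn : 4 * m ≤ n) :
    (((n : ℝ) + 1) / 2) ^ d ≤ (gridInterior d n m).card := by
  rw [card_gridInterior, Nat.cast_pow]
  refine pow_le_pow_left₀ (by positivity) ?_ d
  have hn' : (4 * m : ℝ) ≤ n := by exact_mod_cast hn
  rw [show n - m + 1 - m = n + 1 - 2 * m by omega, Nat.cast_sub (by omega)]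
  push_cast
  linarith

theorem gridPoint_sub_apply (h : ℝ) (i j : Fin d → ℕ) (g : Fin d) :
    (gridPoint h i - gridPoint h j) g = h * ((i g : ℝ) - j g) := by
  simp [gridPoint, mul_sub]

theorem rpow_neg_add_norm_gridPoint_sub_le (hd : 1 ≤ d) {h σ s : ℝ} (hh : 0 < h) (hs : 0 ≤ s)
    (hsσ : s ≤ σ) (i j : Fin d → ℕ) :
    (h + ‖gridPoint h i - gridPoint h j‖) ^ (-σ) ≤
      h ^ (-σ) * ∏ g, (1 + |(i g : ℝ) - j g|) ^ (-(s / d)) := by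
  have hd₀ : (0 : ℝ) < d := by exact_mod_cast hd
  obtain ⟨y, hy⟩ : ∃ y, h + ‖gridPoint h i - gridPoint h j‖ = h * y :=
    ⟨_, (mul_div_cancel₀ _ hh.ne').symm⟩
  have hyg : ∀ g, 1 + |(i g : ℝ) - j g| ≤ y := by
    intro g
    have hcoord := PiLp.norm_apply_le (gridPoint h i - gridPoint h j) g
    rw [gridPoint_sub_apply, Real.norm_eq_abs, abs_mul, abs_of_pos hh] at hcoord
    exact le_of_mul_le_mul_left (by linarith) hh
  have hy₁ : 1 ≤ y := (le_add_of_nonneg_right (abs_nonneg _)).trans (hyg ⟨0, hd⟩)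
  have hy₀ : 0 < y := by linarith
  rw [hy, Real.mul_rpow hh.le hy₀.le]
  refine mul_le_mul_of_nonneg_left ?_ (Real.rpow_nonneg hh.le _)
  calc y ^ (-σ) ≤ y ^ (-s) := Real.rpow_le_rpow_of_exponent_le hy₁ (by linarith)
    _ = ∏ _g : Fin d, y ^ (-(s / d)) := by
        rw [Finset.prod_const, Finset.card_univ, Fintype.card_fin, ← Real.rpow_mul_natCast hy₀.le,
          neg_mul, div_mul_cancel₀ _ hd₀.ne']
    _ ≤ _ := Finset.prod_le_prod (fun _ _ => by positivity) fun g _ =>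
        Real.rpow_le_rpow_of_nonpos (by positivity) (hyg g) (by rw [neg_nonpos]; positivity)

theorem sum_gridInterior_prod_le {θ : ℝ} (hθ₀ : 0 ≤ θ) (hθ₁ : θ < 1) {i : Fin d → ℕ}
    (hi : i ∈ gridInterior d n m) :
    ∑ j ∈ gridInterior d n m, ∏ g, (1 + |(i g : ℝ) - j g|) ^ (-θ) ≤
      (2 / (1 - θ) * ((n : ℝ) + 1) ^ (1 - θ)) ^ d := by
  rw [gridInterior, ← Finset.prod_univ_sum (fun _ : Fin d => Finset.Icc m (n - m))
    (fun g b => (1 + |(i g : ℝ) - b|) ^ (-θ))]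
  calc _ ≤ ∏ _g : Fin d, (2 / (1 - θ) * ((n : ℝ) + 1) ^ (1 - θ)) := by
        refine Finset.prod_le_prod (fun g _ => Finset.sum_nonneg fun b _ => by positivity)
          fun g _ => ?_
        refine (Finset.sum_le_sum_of_subset_of_nonneg (fun b hb => ?_) fun _ _ _ =>
          by positivity).trans
            (sum_range_one_add_abs_sub_rpow_neg_le hθ₀ hθ₁ (le_of_mem_gridInterior hi g))
        rw [Finset.mem_Icc] at hb
        exact Finset.mem_range.2 (by omega)
    _ = _ := by simp

theorem sum_gridInterior_rpow_neg_le (hd : 1 ≤ d) {h σ s : ℝ} (hh : 0 < h) (hs : 0 ≤ s)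
    (hsd : s < d) (hsσ : s ≤ σ) {i : Fin d → ℕ} (hi : i ∈ gridInterior d n m) :
    ∑ j ∈ gridInterior d n m, (h + ‖gridPoint h i - gridPoint h j‖) ^ (-σ) ≤
      (2 / (1 - s / d)) ^ d * h ^ (-σ) * ((n : ℝ) + 1) ^ (d - s) := by
  have hd₀ : (0 : ℝ) < d := by exact_mod_cast hd
  calc _ ≤ ∑ j ∈ gridInterior d n m,
          h ^ (-σ) * ∏ g, (1 + |(i g : ℝ) - j g|) ^ (-(s / d)) :=
        Finset.sum_le_sum fun j _ => rpow_neg_add_norm_gridPoint_sub_le hd hh hs hsσ i j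
    _ ≤ h ^ (-σ) * (2 / (1 - s / d) * ((n : ℝ) + 1) ^ (1 - s / d)) ^ d := by
        rw [← Finset.mul_sum]
        exact mul_le_mul_of_nonneg_left (sum_gridInterior_prod_le (by positivity)
          ((div_lt_one hd₀).2 hsd) hi) (Real.rpow_nonneg hh.le _)
    _ = _ := by
        rw [mul_pow, ← Real.rpow_mul_natCast (by positivity), sub_mul, one_mul,
          div_mul_cancel₀ _ hd₀.ne']
        ring

theorem sum_sum_gridInterior_rpow_neg_le (hd : 1 ≤ d) {L σ s : ℝ} (hL : 0 < L) (hs : 0 ≤ s)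
    (hsd : s < d) (hsσ : s ≤ σ) (hn : 0 < n) (hmn : 4 * m ≤ n) :
    ∑ i ∈ gridInterior d n m, ∑ j ∈ gridInterior d n m,
        (L / n + ‖gridPoint (L / n) i - gridPoint (L / n) j‖) ^ (-σ) ≤
      ((gridInterior d n m).card : ℝ) ^ 2 *
        ((4 / (1 - s / d)) ^ d * L ^ (-s) * (L / n) ^ (s - σ)) := by
  have hn₀ : (0 : ℝ) < n := by exact_mod_cast hn
  have hd₀ : (0 : ℝ) < d := by exact_mod_cast hd
  have hθ : 0 < 1 - s / d := by rw [sub_pos, div_lt_one hd₀]; exact hsd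
  have hh : 0 < L / (n : ℝ) := div_pos hL hn₀
  have hbox : ((n : ℝ) + 1) ^ (d - s) ≤
      2 ^ d * (gridInterior d n m).card * (L ^ (-s) * (L / n) ^ s) := by
    calc ((n : ℝ) + 1) ^ (d - s) = 2 ^ d * (((n : ℝ) + 1) / 2) ^ d * ((n : ℝ) + 1) ^ (-s) := by
          rw [sub_eq_add_neg, Real.rpow_add (by positivity), Real.rpow_natCast, ← mul_pow]
          congr 2
          ring
      _ ≤ 2 ^ d * (gridInterior d n m).card * (n : ℝ) ^ (-s) := by
          gcongr 2 ^ d * ?_ * ?_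
          · exact half_pow_le_card_gridInterior hmn
          · exact Real.rpow_le_rpow_of_nonpos hn₀ (by linarith) (by linarith)
      _ = _ := by
          rw [Real.div_rpow hL.le hn₀.le, Real.rpow_neg hL.le, Real.rpow_neg hn₀.le]
          have := (Real.rpow_pos_of_pos hL s).ne'
          field_simp
  calc _ ≤ ((gridInterior d n m).card : ℝ) *
          ((2 / (1 - s / d)) ^ d * (L / n) ^ (-σ) * ((n : ℝ) + 1) ^ (d - s)) := by
        rw [← nsmul_eq_mul]
        exact Finset.sum_le_card_nsmul _ _ _ fun i hi =>
          sum_gridInterior_rpow_neg_le hd hh hs hsd hsσ hi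
    _ ≤ ((gridInterior d n m).card : ℝ) * ((2 / (1 - s / d)) ^ d * (L / n) ^ (-σ) *
          (2 ^ d * (gridInterior d n m).card * (L ^ (-s) * (L / n) ^ s))) := by gcongr
    _ = _ := by
        rw [sub_eq_add_neg s, Real.rpow_add hh, show (4 : ℝ) / (1 - s / d) = 2 / (1 - s / d) * 2 by
          ring, mul_pow]
        ring

theorem tendsto_const_div_nhdsGT_zero {L : ℝ} (hL : 0 < L) :
    Tendsto (fun n : ℕ => L / (n : ℝ)) atTop (𝓝[>] 0) := by
  refine tendsto_nhdsWithin_iff.2 ⟨tendsto_const_div_atTop_nhds_zero_nat L, ?_⟩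
  filter_upwards [eventually_gt_atTop 0] with n hn
  exact div_pos hL (by exact_mod_cast hn)

theorem tendsto_sum_sum_gridInterior_rpow_neg (hd : 1 ≤ d) {L : ℝ} (hL : 0 < L) (m : ℕ) {ρ σ : ℝ}
    (hρ : 0 < ρ) (hσ₀ : 0 ≤ σ) (hσ : σ < 2 * ρ + d) :
    Tendsto (fun n : ℕ => (L / n) ^ (2 * ρ) / ((gridInterior d n m).card : ℝ) ^ 2 *
      ∑ i ∈ gridInterior d n m, ∑ j ∈ gridInterior d n m,
        (L / n + ‖gridPoint (L / n) i - gridPoint (L / n) j‖) ^ (-σ)) atTop (𝓝 0) := by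
  have hd₀ : (0 : ℝ) < d := by exact_mod_cast hd
  obtain ⟨s, hs₀, hsσ, hsd, hs⟩ : ∃ s : ℝ, 0 ≤ s ∧ s ≤ σ ∧ s < d ∧ 0 < 2 * ρ + (s - σ) := by
    rcases lt_or_ge σ d with h | h
    · exact ⟨σ, hσ₀, le_rfl, h, by linarith⟩
    · refine ⟨max 0 ((σ - 2 * ρ + d) / 2), le_max_left _ _, max_le hσ₀ (by linarith),
        max_lt hd₀ (by linarith), ?_⟩
      linarith [le_max_right 0 ((σ - 2 * ρ + d) / 2)]
  set K : ℝ := (4 / (1 - s / d)) ^ d * L ^ (-s)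
  have hlim : Tendsto (fun n : ℕ => K * (L / (n : ℝ)) ^ (2 * ρ + (s - σ))) atTop (𝓝 0) := by
    simpa using ((tendsto_rpow_nhdsGT_zero hs).comp (tendsto_const_div_nhdsGT_zero hL)).const_mul K
  refine tendsto_of_tendsto_of_tendsto_of_le_of_le' tendsto_const_nhds hlim
    (Eventually.of_forall fun n => by positivity) ?_
  filter_upwards [eventually_ge_atTop (4 * m), eventually_gt_atTop 0] with n hmn hn
  have hh : 0 < L / (n : ℝ) := div_pos hL (by exact_mod_cast hn)
  have hcard : ((gridInterior d n m).card : ℝ) ≠ 0 := by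
    exact_mod_cast (card_gridInterior_pos (d := d) (by omega)).ne'
  calc _ ≤ (L / n) ^ (2 * ρ) / ((gridInterior d n m).card : ℝ) ^ 2 *
          (((gridInterior d n m).card : ℝ) ^ 2 * (K * (L / n) ^ (s - σ))) :=
        mul_le_mul_of_nonneg_left
          (sum_sum_gridInterior_rpow_neg_le hd hL hs₀ hsd hsσ hn hmn) (by positivity)
    _ = _ := by
        rw [Real.rpow_add hh]
        field_simp

end Grid

section GridBlocks

variable {d n N : ℕ}

/-- The index of the block of the partition of the grid into cubes of side a fraction `1 / N` of
the whole to which the point of index `j` belongs; the grid has `n` steps in each direction. -/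
def blockIndex (n N : ℕ) (j : Fin d → ℕ) : Fin d → ℕ := fun g => j g * N / n

theorem blockIndex_mem {m : ℕ} {j : Fin d → ℕ} (hj : j ∈ gridInterior d n m) :
    blockIndex n N j ∈ Fintype.piFinset fun _ : Fin d => Finset.range (N + 1) := by
  rw [Fintype.mem_piFinset]
  intro g
  rw [Finset.mem_range, Nat.lt_succ_iff, blockIndex]
  exact Nat.div_le_of_le_mul (Nat.mul_le_mul_right N (le_of_mem_gridInterior hj g))

theorem abs_sub_le_of_blockIndex_eq (hn : 0 < n) (hN : 0 < N) {i j : Fin d → ℕ}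
    (hij : blockIndex n N i = blockIndex n N j) (g : Fin d) :
    |(i g : ℝ) - j g| ≤ n / N := by
  have hsub : ∀ i j : Fin d → ℕ, blockIndex n N i = blockIndex n N j →
      ((i g : ℝ) - j g) * N ≤ n := by
    intro i j hij
    have hi : i g * N < n * (i g * N / n) + n := Nat.lt_mul_div_succ _ hn
    have hj : n * (j g * N / n) ≤ j g * N := Nat.mul_div_le _ _
    have hg : i g * N / n = j g * N / n := congrFun hij g
    rw [← hg] at hj
    have hle : (i g : ℝ) * N ≤ j g * N + n := by exact_mod_cast (by omega)
    linarith
  have hN₀ : (0 : ℝ) < N := by exact_mod_cast hN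
  refine abs_le'.2 ⟨(le_div_iff₀ hN₀).2 (hsub i j hij), (le_div_iff₀ hN₀).2 ?_⟩
  rw [neg_sub]
  exact hsub j i hij.symm

theorem norm_le_mul_of_abs_apply_le {x : EuclideanSpace ℝ (Fin d)} {r : ℝ}
    (hx : ∀ g, |x g| ≤ r) : ‖x‖ ≤ d * r := by
  have hsum : x = ∑ g, x g • (EuclideanSpace.single g (1 : ℝ) : EuclideanSpace ℝ (Fin d)) := by
    ext g
    simp [Pi.single_apply]
  calc ‖x‖ ≤ ∑ g, ‖x g • (EuclideanSpace.single g (1 : ℝ) : EuclideanSpace ℝ (Fin d))‖ := by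
        nth_rewrite 1 [hsum]
        exact norm_sum_le _ _
    _ ≤ ∑ _g : Fin d, r := Finset.sum_le_sum fun g _ => by
        rw [norm_smul_single_one]
        exact hx g
    _ = d * r := by simp

theorem norm_gridPoint_sub_le_of_blockIndex_eq (hn : 0 < n) (hN : 0 < N) {L : ℝ} (hL : 0 < L)
    {i j : Fin d → ℕ} (hij : blockIndex n N i = blockIndex n N j) :
    ‖gridPoint (L / n) i - gridPoint (L / n) j‖ ≤ d * (L / N) := by
  have hn₀ : (0 : ℝ) < n := by exact_mod_cast hn
  refine norm_le_mul_of_abs_apply_le fun g => ?_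
  rw [gridPoint_sub_apply, abs_mul, abs_of_pos (div_pos hL hn₀)]
  calc L / n * |(i g : ℝ) - j g| ≤ L / n * (n / N) := by
        gcongr
        exact abs_sub_le_of_blockIndex_eq hn hN hij g
    _ = L / N := by field_simp

end GridBlocks

section GridAverages

variable {d : ℕ} {Ω : Type*} [MeasurableSpace Ω] {P : Measure Ω} {L ρ σ : ℝ}

/-- The average of `f` over the points of the grid of mesh `L / n` with `m` outer layers removed.
Numerator and denominator of the estimator are, up to the same factor, such averages. -/
noncomputable def gridAverage (L : ℝ) (m n : ℕ) (f : EuclideanSpace ℝ (Fin d) → ℝ) : ℝ :=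
  (∑ j ∈ gridInterior d n m, f (gridPoint (L / n) j)) / (gridInterior d n m).card

theorem memLp_gridAverage {Y : EuclideanSpace ℝ (Fin d) → Ω → ℝ} (hY : ∀ s, MemLp (Y s) 2 P)
    (m n : ℕ) : MemLp (fun ω => gridAverage L m n fun s => Y s ω) 2 P := by
  simp only [gridAverage, div_eq_inv_mul]
  exact (memLp_finsetSum _ fun j _ => hY _).const_mul _

theorem integral_gridAverage {Y : EuclideanSpace ℝ (Fin d) → Ω → ℝ}
    (hY : ∀ s, Integrable (Y s) P) {μ : ℝ} (hμ : ∀ s, ∫ ω, Y s ω ∂P = μ) {m n : ℕ}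
    (hn : 2 * m ≤ n) : ∫ ω, gridAverage L m n (fun s => Y s ω) ∂P = μ := by
  have hcard : ((gridInterior d n m).card : ℝ) ≠ 0 := by
    exact_mod_cast (card_gridInterior_pos hn).ne'
  simp only [gridAverage]
  rw [integral_div, integral_finsetSum _ fun j _ => hY _]
  simp only [hμ, Finset.sum_const, nsmul_eq_mul]
  field_simp

/-- Splitting the grid into boundedly many blocks reduces the variance to covariances at lags small
enough for the bound on `V` to apply. -/
theorem tendsto_variance_rpow_mul_gridAverage [IsProbabilityMeasure P] (hd : 1 ≤ d) (hL : 0 < L)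
    (m : ℕ) (hρ : 0 < ρ) (hσ₀ : 0 ≤ σ) (hσ : σ < 2 * ρ + d)
    {Y : ℝ → EuclideanSpace ℝ (Fin d) → Ω → ℝ} (hY : ∀ h s, MemLp (Y h s) 2 P)
    {V : ℝ → EuclideanSpace ℝ (Fin d) → ℝ} (hYV : ∀ h s t, cov[Y h s, Y h t; P] = V h (s - t))
    (hV : (fun z : ℝ × EuclideanSpace ℝ (Fin d) => V z.1 z.2)
      =O[𝓝[>] 0 ×ˢ 𝓝 0] fun z => (z.1 + ‖z.2‖) ^ (-σ)) :
    Tendsto (fun n : ℕ =>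
      Var[fun ω => (L / n) ^ ρ * gridAverage L m n fun s => Y (L / n) s ω; P]) atTop (𝓝 0) := by
  obtain ⟨D, hD₀, hD⟩ := hV.exists_nonneg
  obtain ⟨A, hA, B, hB, hAB⟩ := eventually_prod_iff.1 hD.bound
  obtain ⟨δ, hδ, hBδ⟩ := Metric.eventually_nhds_iff.1 hB
  obtain ⟨N, hN⟩ := exists_nat_gt (d * L / δ)
  have hN₀ : (0 : ℝ) < N := lt_of_le_of_lt (by positivity) hN
  have hNδ : d * (L / N) < δ := by
    rw [div_lt_iff₀ hδ] at hN
    rw [← mul_div_assoc, div_lt_iff₀ hN₀]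
    linarith
  set Q := Fintype.piFinset fun _ : Fin d => Finset.range (N + 1)
  have hlim := (tendsto_sum_sum_gridInterior_rpow_neg hd hL m hρ hσ₀ hσ).const_mul (Q.card * D)
  rw [mul_zero] at hlim
  refine tendsto_of_tendsto_of_tendsto_of_le_of_le' tendsto_const_nhds hlim
    (Eventually.of_forall fun n => variance_nonneg _ _) ?_
  filter_upwards [(tendsto_const_div_nhdsGT_zero hL).eventually hA, eventually_gt_atTop 0]
    with n hAn hn
  have hh : 0 < L / (n : ℝ) := div_pos hL (by exact_mod_cast hn)
  have hcov : ∀ i ∈ gridInterior d n m, ∀ j ∈ gridInterior d n m,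
      blockIndex n N i = blockIndex n N j →
      |cov[Y (L / n) (gridPoint (L / n) i), Y (L / n) (gridPoint (L / n) j); P]| ≤
        D * (L / n + ‖gridPoint (L / n) i - gridPoint (L / n) j‖) ^ (-σ) := by
    intro i _ j _ hij
    have hlag := (norm_gridPoint_sub_le_of_blockIndex_eq hn (by exact_mod_cast hN₀) hL
      hij).trans_lt hNδ
    rw [hYV]
    refine (hAB hAn (hBδ (by rwa [dist_zero_right]))).trans_eq ?_
    rw [Real.norm_of_nonneg (Real.rpow_nonneg (by positivity) _)]
  have hblocks := variance_fun_sum_le_of_abs_covariance_fiber_le (P := P) (t := Q)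
    (fun i hi => blockIndex_mem hi) (fun i _ => hY _ _) (fun i j => by positivity) hcov
  have hsq : (L / (n : ℝ)) ^ (2 * ρ) = ((L / n) ^ ρ) ^ 2 := by
    rw [mul_comm, Real.rpow_mul hh.le, Real.rpow_two]
  simp only [gridAverage, div_eq_inv_mul (Finset.sum _ _), ← mul_assoc]
  rw [variance_const_mul]
  refine (mul_le_mul_of_nonneg_left hblocks (sq_nonneg _)).trans_eq ?_
  simp only [← Finset.mul_sum]
  rw [hsq]
  ring

theorem tendstoInMeasure_rpow_mul_gridAverage [IsProbabilityMeasure P] (hd : 1 ≤ d) (hL : 0 < L)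
    (m : ℕ) (hρ : 0 < ρ) (hσ₀ : 0 ≤ σ) (hσ : σ < 2 * ρ + d)
    {Y : ℝ → EuclideanSpace ℝ (Fin d) → Ω → ℝ} (hY : ∀ h s, MemLp (Y h s) 2 P)
    {μ : ℝ → ℝ} (hYμ : ∀ h s, ∫ ω, Y h s ω ∂P = μ h) {κ : ℝ}
    (hμ : Tendsto (fun h => h ^ ρ * μ h) (𝓝[>] 0) (𝓝 κ))
    {V : ℝ → EuclideanSpace ℝ (Fin d) → ℝ} (hYV : ∀ h s t, cov[Y h s, Y h t; P] = V h (s - t))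
    (hV : (fun z : ℝ × EuclideanSpace ℝ (Fin d) => V z.1 z.2)
      =O[𝓝[>] 0 ×ˢ 𝓝 0] fun z => (z.1 + ‖z.2‖) ^ (-σ)) :
    TendstoInMeasure P (fun (n : ℕ) ω => (L / n) ^ ρ * gridAverage L m n fun s => Y (L / n) s ω)
      atTop (fun _ => κ) := by
  refine tendstoInMeasure_of_tendsto_integral_of_tendsto_variance
    (fun n => (memLp_gridAverage (hY _) m n).const_mul _) ?_
    (tendsto_variance_rpow_mul_gridAverage hd hL m hρ hσ₀ hσ hY hYV hV)
  refine (hμ.comp (tendsto_const_div_nhdsGT_zero hL)).congr' ?_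
  filter_upwards [eventually_ge_atTop (2 * m)] with n hn
  rw [integral_const_mul, integral_gridAverage (fun s => (hY _ s).integrable one_le_two) (hYμ _) hn,
    Function.comp_apply]

end GridAverages

section PowerBounds

variable {E : Type*} [SeminormedAddCommGroup E]

theorem isBigO_mul_rpow_neg {F G : ℝ × E → ℝ} {a b σ : ℝ} (hab : a + b ≤ σ)
    (hF : F =O[𝓝[>] 0 ×ˢ 𝓝 0] fun z => (z.1 + ‖z.2‖) ^ (-a))
    (hG : G =O[𝓝[>] 0 ×ˢ 𝓝 0] fun z => (z.1 + ‖z.2‖) ^ (-b)) :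
    (fun z => F z * G z) =O[𝓝[>] 0 ×ˢ 𝓝 0] fun z => (z.1 + ‖z.2‖) ^ (-σ) := by
  refine (hF.mul hG).trans (IsBigO.of_bound 1 ?_)
  filter_upwards [prod_mem_prod (Ioo_mem_nhdsGT one_half_pos)
    (Metric.ball_mem_nhds (0 : E) one_half_pos)] with z hz
  have hz₁ : 0 < z.1 := hz.1.1
  have hz₂ : ‖z.2‖ < 1 / 2 := mem_ball_zero_iff.1 hz.2
  have hr : 0 < z.1 + ‖z.2‖ := by positivity
  rw [← Real.rpow_add hr, Real.norm_of_nonneg (by positivity), Real.norm_of_nonneg (by positivity),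
    one_mul]
  exact Real.rpow_le_rpow_of_exponent_ge hr (by linarith [hz.1.2]) (by linarith)

theorem tendsto_rpow_mul_of_isBigO {F : ℝ × E → ℝ} {a ρ : ℝ} (haρ : a < ρ)
    (hF : F =O[𝓝[>] 0 ×ˢ 𝓝 0] fun z => (z.1 + ‖z.2‖) ^ (-a)) :
    Tendsto (fun h : ℝ => h ^ ρ * F (h, 0)) (𝓝[>] 0) (𝓝 0) := by
  have hF₀ := hF.comp_tendsto (tendsto_id.prodMk (tendsto_const_nhds (x := (0 : E))))
  refine (((isBigO_refl (fun h : ℝ => h ^ ρ) _).mul hF₀).congr' .rfl ?_).trans_tendsto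
    (tendsto_rpow_nhdsGT_zero (sub_pos.2 haρ))
  filter_upwards [self_mem_nhdsWithin] with h (hh : 0 < h)
  rw [Function.comp_apply, norm_zero, id, add_zero, ← Real.rpow_add hh, ← sub_eq_add_neg]

end PowerBounds

section Consistency

variable {d : ℕ} {Ω : Type*} [MeasurableSpace Ω] {P : Measure Ω} {L : ℝ} {m : ℕ}
  {X W : EuclideanSpace ℝ (Fin d) → Ω → ℝ} {C : Fin 2 → Fin 2 → EuclideanSpace ℝ (Fin d) → ℝ}
  {α : Fin 2 → Fin 2 → ℝ}

namespace IsIsotropicUpToRemainder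

theorem exponent_pos (hC : IsIsotropicUpToRemainder C L α) (hL : 0 < L) (k l : Fin 2) :
    0 < α k l := by
  obtain ⟨_, -, hα, -⟩ := hC.exists_hasLocalExpansion hL k l
  exact hα

theorem ne_zero_of_exponent_lt (hC : IsIsotropicUpToRemainder C L α) (hL : 0 < L) {k l : Fin 2}
    (hm : α k l < 4 * m) : m ≠ 0 := by
  rintro rfl
  rw [Nat.cast_zero, mul_zero] at hm
  exact hm.not_gt (hC.exponent_pos hL k l)

theorem isBigO_iterate_discreteLaplacian (hC : IsIsotropicUpToRemainder C L α) (hL : 0 < L)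
    (m : ℕ) (k l : Fin 2) :
    (fun z : ℝ × EuclideanSpace ℝ (Fin d) => (discreteLaplacian z.1)^[2 * m] (C k l) z.2)
      =O[𝓝[>] 0 ×ˢ 𝓝 0] fun z => (z.1 + ‖z.2‖) ^ (-max (4 * m - α k l) 0) := by
  obtain ⟨c, -, hα, -, hf⟩ := hC.exists_hasLocalExpansion hL k l
  have hbound := hf.isBigO_iterate_discreteLaplacian hα (2 * m)
  rwa [show 2 * ((2 * m : ℕ) : ℝ) = 4 * m by push_cast; ring] at hbound

end IsIsotropicUpToRemainder

namespace IsStationaryGRF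

/-- Cauchy–Schwarz bounds the limits at all lags by the limit at lag `0`, and they do not all
vanish. -/
theorem exists_pos_tendsto_iterate_discreteLaplacian (hZ : IsStationaryGRF P X W C) (hd : 1 ≤ d)
    (hL : 0 < L) (hC : IsIsotropicUpToRemainder C L α) (k : Fin 2) (hm : α k k < 4 * m) :
    ∃ κ > 0, Tendsto
      (fun h : ℝ => h ^ (4 * m - α k k) * (discreteLaplacian h)^[2 * m] (C k k) 0)
      (𝓝[>] 0) (𝓝 κ) := by
  obtain ⟨c, hc, -, hα, hf⟩ := hC.exists_hasLocalExpansion hL k k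
  have hcast : 2 * ((2 * m : ℕ) : ℝ) = 4 * m := by push_cast; ring
  have hlim := hf.tendsto_iterate_discreteLaplacian (hm.trans_eq hcast.symm)
  rw [hcast] at hlim
  obtain ⟨u, hu⟩ := exists_iterate_discreteLaplacian_norm_rpow_ne_zero hd hα (2 * m)
  have hlim₀ := hlim 0
  simp only [smul_zero] at hlim₀
  refine ⟨_, (abs_pos.2 (mul_ne_zero (hc rfl) hu)).trans_le ?_, hlim₀⟩
  refine le_of_tendsto_of_tendsto (hlim u).abs hlim₀ ?_
  filter_upwards [self_mem_nhdsWithin] with h (hh : 0 < h)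
  rw [abs_mul, abs_of_pos (Real.rpow_pos_of_pos hh _)]
  exact mul_le_mul_of_nonneg_left (hZ.abs_iterate_discreteLaplacian_le m h k _)
    (Real.rpow_nonneg hh.le _)

theorem tendstoInMeasure_gridAverage_laplacianField_mul (hZ : IsStationaryGRF P X W C)
    (hd : 1 ≤ d) (hL : 0 < L) (hm : m ≠ 0) (k l : Fin 2) {ρ a b c σ κ : ℝ} (hρ : 0 < ρ)
    (hσ₀ : 0 ≤ σ) (hσ : σ < 2 * ρ + d) (hab : a + b ≤ σ) (hcc : c + c ≤ σ) (hsymm : C l k = C k l)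
    (hkk : (fun z : ℝ × EuclideanSpace ℝ (Fin d) => (discreteLaplacian z.1)^[2 * m] (C k k) z.2)
      =O[𝓝[>] 0 ×ˢ 𝓝 0] fun z => (z.1 + ‖z.2‖) ^ (-a))
    (hll : (fun z : ℝ × EuclideanSpace ℝ (Fin d) => (discreteLaplacian z.1)^[2 * m] (C l l) z.2)
      =O[𝓝[>] 0 ×ˢ 𝓝 0] fun z => (z.1 + ‖z.2‖) ^ (-b))
    (hkl : (fun z : ℝ × EuclideanSpace ℝ (Fin d) => (discreteLaplacian z.1)^[2 * m] (C k l) z.2)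
      =O[𝓝[>] 0 ×ˢ 𝓝 0] fun z => (z.1 + ‖z.2‖) ^ (-c))
    (hκ : Tendsto (fun h : ℝ => h ^ ρ * (discreteLaplacian h)^[2 * m] (C k l) 0)
      (𝓝[>] 0) (𝓝 κ)) :
    TendstoInMeasure P (fun (n : ℕ) ω => (L / n) ^ ρ * gridAverage L m n fun s =>
      laplacianField X W m (L / n) k s ω * laplacianField X W m (L / n) l s ω)
      atTop (fun _ => κ) := by
  have := hZ.gaussian.isProbabilityMeasure
  refine tendstoInMeasure_rpow_mul_gridAverage
    (Y := fun h s ω => laplacianField X W m h k s ω * laplacianField X W m h l s ω)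
    (V := fun h u => (discreteLaplacian h)^[2 * m] (C k k) u *
        (discreteLaplacian h)^[2 * m] (C l l) u +
      (discreteLaplacian h)^[2 * m] (C k l) u * (discreteLaplacian h)^[2 * m] (C l k) u)
    hd hL m hρ hσ₀ hσ (fun h s => hZ.memLp_two_laplacianField_mul m h k l s s)
    (fun h s => ?_) hκ (fun h s t => hZ.covariance_laplacianField_mul hm h k l s t) ?_
  · rw [hZ.integral_laplacianField_mul hm, sub_self]
  · rw [hsymm]
    exact (isBigO_mul_rpow_neg hab hkk hll).add (isBigO_mul_rpow_neg hcc hkl hkl)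

end IsStationaryGRF

theorem lapEstimator_mul_add {Z₁ Z₂ : EuclideanSpace ℝ (Fin d) → ℝ} (β : ℝ) {n : ℕ}
    (hn : 2 * m ≤ n) {r : ℝ} (hr : r ≠ 0) :
    lapEstimator L m n Z₁ (fun s => Z₁ s * β + Z₂ s) =
      (r * gridAverage L m n (fun s => (discreteLaplacian (L / n))^[m] Z₁ s *
            (discreteLaplacian (L / n))^[m] Z₁ s) * β +
        r * gridAverage L m n (fun s => (discreteLaplacian (L / n))^[m] Z₁ s *
            (discreteLaplacian (L / n))^[m] Z₂ s)) /
      (r * gridAverage L m n (fun s => (discreteLaplacian (L / n))^[m] Z₁ s *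
            (discreteLaplacian (L / n))^[m] Z₁ s)) := by
  have hcard : ((gridInterior d n m).card : ℝ) ≠ 0 := by
    exact_mod_cast (card_gridInterior_pos hn).ne'
  have hlap : ∀ h, (discreteLaplacian h)^[m] (fun s => Z₁ s * β + Z₂ s) =
      β • (discreteLaplacian h)^[m] Z₁ + (discreteLaplacian h)^[m] Z₂ := by
    intro h
    rw [← iterate_discreteLaplacian_smul, ← iterate_discreteLaplacian_add]
    congr 1
    funext s
    rw [Pi.add_apply, Pi.smul_apply, smul_eq_mul, mul_comm]
  rw [mul_assoc, ← mul_add, mul_div_mul_left _ _ hr]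
  simp only [gridAverage, lapEstimator, hlap, Pi.add_apply, Pi.smul_apply, smul_eq_mul]
  rw [div_mul_eq_mul_div, ← add_div, div_div_div_cancel_right₀ hcard, Finset.sum_mul,
    ← Finset.sum_add_distrib]
  congr 1
  · exact Finset.sum_congr rfl fun j _ => by ring
  · exact Finset.sum_congr rfl fun j _ => by ring

theorem tendstoInMeasure_lapEstimator (hd : 1 ≤ d) (hL : 0 < L)
    {Y : EuclideanSpace ℝ (Fin d) → Ω → ℝ} {β : ℝ} (hY : ∀ s ω, Y s ω = X s ω * β + W s ω)
    (hZ : IsStationaryGRF P X W C) (hC : IsIsotropicUpToRemainder C L α) (h01 : α 0 0 < α 0 1)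
    (h11 : α 0 0 < α 1 1 + d) (hm : α 0 0 < 4 * m) :
    TendstoInMeasure P (fun n ω => lapEstimator L m n (fun s => X s ω) (fun s => Y s ω))
      atTop (fun _ => β) := by
  have hm₀ : m ≠ 0 := hC.ne_zero_of_exponent_lt hL hm
  obtain ⟨κ, hκ, hκlim⟩ := hZ.exists_pos_tendsto_iterate_discreteLaplacian hd hL hC 0 hm
  have hbound := hC.isBigO_iterate_discreteLaplacian hL m
  have hbound₀₀ := hbound 0 0
  set ρ := 4 * m - α 0 0
  set ρ₁ := max (4 * m - α 1 1) 0
  set ρ₂ := max (4 * m - α 0 1) 0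
  have hd₀ : (0 : ℝ) < d := by exact_mod_cast hd
  have hρ : 0 < ρ := sub_pos.2 hm
  have hρ₁ : ρ₁ < ρ + d := max_lt (by linarith) (by linarith)
  have hρ₂ : ρ₂ < ρ := max_lt (by linarith) hρ
  rw [max_eq_left hρ.le] at hbound₀₀
  have hden := hZ.tendstoInMeasure_gridAverage_laplacianField_mul hd hL hm₀ 0 0 hρ (σ := ρ + ρ)
    (by linarith) (by linarith) le_rfl le_rfl rfl hbound₀₀ hbound₀₀ hbound₀₀ hκlim
  have hnum := hZ.tendstoInMeasure_gridAverage_laplacianField_mul hd hL hm₀ 0 1 hρ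
    (le_max_of_le_left (by positivity)) (max_lt (by linarith) (by linarith))
    (le_max_left (ρ + ρ₁) (ρ₂ + ρ₂)) (le_max_right _ _) hC.cross_symm.symm hbound₀₀ (hbound 1 1)
    (hbound 0 1) (tendsto_rpow_mul_of_isBigO hρ₂ (hbound 0 1))
  have hratio := tendstoInMeasure_of_continuousAt₂ (f := fun q : ℝ × ℝ => (q.1 * β + q.2) / q.1)
    (ContinuousAt.div (by fun_prop) (by fun_prop) hκ.ne') hden hnum
  simp only [add_zero, mul_div_cancel_left₀ β hκ.ne'] at hratio
  refine hratio.congr' ?_ .rfl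
  filter_upwards [eventually_ge_atTop (2 * m)] with n hn
  have hr : (L / (n : ℝ)) ^ ρ ≠ 0 :=
    (Real.rpow_pos_of_pos (div_pos hL (by exact_mod_cast (by omega))) _).ne'
  refine Eventually.of_forall fun ω => ?_
  simp only [hY]
  exact (lapEstimator_mul_add β hn hr).symm

end Consistency

section PathSpace

variable {d : ℕ} {L : ℝ}

open Classical in
/-- Extension by zero of a path on the cube, to feed it to the estimator, which is defined for
functions on the whole space. -/
noncomputable def extendByZero (p : cube d L → ℝ) (s : EuclideanSpace ℝ (Fin d)) : ℝ :=
  if hs : s ∈ cube d L then p ⟨s, hs⟩ else 0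

theorem extendByZero_of_mem {p : cube d L → ℝ} {s : EuclideanSpace ℝ (Fin d)}
    (hs : s ∈ cube d L) : extendByZero p s = p ⟨s, hs⟩ :=
  dif_pos hs

theorem measurable_extendByZero :
    Measurable (extendByZero : (cube d L → ℝ) → EuclideanSpace ℝ (Fin d) → ℝ) := by
  refine measurable_pi_lambda _ fun s => ?_
  unfold extendByZero
  split_ifs with hs
  · exact measurable_pi_apply _
  · exact measurable_const

theorem measurable_iterate_discreteLaplacian_apply (h : ℝ) (m : ℕ)
    (s : EuclideanSpace ℝ (Fin d)) :
    Measurable fun z : EuclideanSpace ℝ (Fin d) → ℝ => (discreteLaplacian h)^[m] z s := by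
  simp only [iterate_discreteLaplacian_eq_sum]
  fun_prop

theorem measurable_lapEstimator (L : ℝ) (m n : ℕ) :
    Measurable fun z : (EuclideanSpace ℝ (Fin d) → ℝ) × (EuclideanSpace ℝ (Fin d) → ℝ) =>
      lapEstimator L m n z.1 z.2 := by
  have hlap := measurable_iterate_discreteLaplacian_apply (d := d) (L / n) m
  unfold lapEstimator
  refine Measurable.div (Finset.measurable_fun_sum _ fun j _ => ?_)
    (Finset.measurable_fun_sum _ fun j _ => ?_)
  · exact ((hlap _).comp measurable_fst).mul ((hlap _).comp measurable_snd)
  · exact ((hlap _).comp measurable_fst).pow_const 2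

theorem mem_cube_of_norm_sub_gridPoint_le (hL : 0 < L) {m n : ℕ} (hm : m ≠ 0) {j : Fin d → ℕ}
    (hj : j ∈ gridInterior d n m) {x : EuclideanSpace ℝ (Fin d)}
    (hx : ‖x - gridPoint (L / n) j‖ ≤ m * (L / n)) : x ∈ cube d L := by
  intro g
  obtain ⟨hmj, hjn⟩ := mem_gridInterior.1 hj g
  have hn : (0 : ℝ) < n := by exact_mod_cast (by omega : 0 < n)
  have hh : 0 < L / (n : ℝ) := div_pos hL hn
  have hmj' : (m : ℝ) ≤ j g := by exact_mod_cast hmj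
  have hjn' : (j g : ℝ) + m ≤ n := by exact_mod_cast (by omega : j g + m ≤ n)
  have hxg : |x g - L / n * j g| ≤ m * (L / n) := (PiLp.norm_apply_le _ g).trans hx
  obtain ⟨hlower, hupper⟩ := abs_le.1 hxg
  constructor
  · linarith [mul_le_mul_of_nonneg_left hmj' hh.le]
  · have hend := mul_le_mul_of_nonneg_left hjn' hh.le
    rw [div_mul_cancel₀ L hn.ne'] at hend
    linarith

theorem lapEstimator_congr (hL : 0 < L) {m : ℕ} (hm : m ≠ 0) (n : ℕ)
    {z₁ z₂ z₁' z₂' : EuclideanSpace ℝ (Fin d) → ℝ} (h₁ : EqOn z₁ z₁' (cube d L))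
    (h₂ : EqOn z₂ z₂' (cube d L)) :
    lapEstimator L m n z₁ z₂ = lapEstimator L m n z₁' z₂' := by
  have hlap : ∀ {z z' : EuclideanSpace ℝ (Fin d) → ℝ}, EqOn z z' (cube d L) →
      ∀ j ∈ gridInterior d n m, (discreteLaplacian (L / n))^[m] z (gridPoint (L / n) j) =
        (discreteLaplacian (L / n))^[m] z' (gridPoint (L / n) j) := by
    intro z z' hz j hj
    have hh : 0 ≤ L / (n : ℝ) := by positivity
    refine iterate_discreteLaplacian_congr fun x hx =>
      hz (mem_cube_of_norm_sub_gridPoint_le hL hm hj ?_)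
    rwa [abs_of_nonneg hh] at hx
  simp only [lapEstimator]
  congr 1
  · exact Finset.sum_congr rfl fun j hj => by rw [hlap h₁ j hj, hlap h₂ j hj]
  · exact Finset.sum_congr rfl fun j hj => by rw [hlap h₁ j hj]

theorem consistentlyEstimable_slopeModels (hd : 1 ≤ d) (hL : 0 < L) (m : ℕ) :
    ConsistentlyEstimable (slopeModels d L m) := by
  have hfst : Measurable fun (p : cube d L → ℝ × ℝ) t => (p t).1 := by fun_prop
  have hsnd : Measurable fun (p : cube d L → ℝ × ℝ) t => (p t).2 := by fun_prop
  have hT : ∀ n, Measurable fun p : cube d L → ℝ × ℝ =>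
      lapEstimator L m n (extendByZero fun t => (p t).1) (extendByZero fun t => (p t).2) :=
    fun n => (measurable_lapEstimator L m n).comp
      ((measurable_extendByZero.comp hfst).prodMk (measurable_extendByZero.comp hsnd))
  refine ⟨_, hT, ?_⟩
  rintro q ⟨Ω, _, P, X, W, C, α, _, hZ, hC, h01, h11, hm, hq⟩
  have hX : ∀ s, Measurable (X s) := hZ.measurable 0
  have hW : ∀ s, Measurable (W s) := hZ.measurable 1
  have hpath : Measurable fun ω (s : cube d L) => (X s ω, X s ω * q.1 + W s ω) :=
    measurable_pi_lambda _ fun s => (hX s).prodMk (((hX s).mul_const _).add (hW s))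
  rw [hq]
  refine tendstoInMeasure_map_of_comp hpath hT ?_
  have hlim := tendstoInMeasure_lapEstimator hd hL (Y := fun s ω => X s ω * q.1 + W s ω)
    (fun _ _ => rfl) hZ hC h01 h11 hm
  refine hlim.congr_left fun n => Eventually.of_forall fun ω => ?_
  exact lapEstimator_congr hL (hC.ne_zero_of_exponent_lt hL hm) n
    (fun s hs => (extendByZero_of_mem (p := fun t => X t ω) hs).symm)
    (fun s hs => (extendByZero_of_mem (p := fun t => X t ω * q.1 + W t ω) hs).symm)

end PathSpace

theorem theorem3 {d : ℕ} (hd : 1 ≤ d) {L : ℝ} (hL : 0 < L) (m : ℕ) :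
    ConsistentlyEstimable (slopeModels d L m) ∧
    ∀ {Ω : Type*} [MeasurableSpace Ω] (P : Measure Ω) [IsProbabilityMeasure P]
      (X W Y : EuclideanSpace ℝ (Fin d) → Ω → ℝ) (β : ℝ)
      (C : Fin 2 → Fin 2 → EuclideanSpace ℝ (Fin d) → ℝ) (α : Fin 2 → Fin 2 → ℝ),
      (∀ s ω, Y s ω = X s ω * β + W s ω) →
      IsStationaryGRF P X W C → IsIsotropicUpToRemainder C L α →
      α 0 0 < α 0 1 → α 0 0 < α 1 1 + d → α 0 0 < 4 * m →
      TendstoInMeasure P (fun n ω => lapEstimator L m n (fun s => X s ω) (fun s => Y s ω))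
        atTop (fun _ => β) :=
  ⟨consistentlyEstimable_slopeModels hd hL m, fun _ _ _ _ _ _ _ _ hY hZ hC h01 h11 hm =>
    tendstoInMeasure_lapEstimator hd hL hY hZ hC h01 h11 hm⟩
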